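/- Let $\mathcal S$ be a finite-dimensional commutative associative real algebra with identity, let $\mathcal S_c=\mathcal S\oplus i\mathcal S$ be its complexification, with conjugation $\overline{X+iY}=X-iY$ and $\mathrm{Re}(X+iY)=X$, $\mathrm{Im}(X+iY)=Y$ for $X,Y\in\mathcal S$. Let $$\mathcal Q=\{(Z,W)\in\mathcal S_c\times\mathcal S_c:\ \mathrm{Im}\,W=Z^2\bar Z^2\}$$ be the $\mathcal S$-algebraization of the hypersurface $\{\mathrm{Im}\,w=z^2\bar z^2\}\subset\mathbb C^2$, regarded as a real submanifold of the complex vector space $\mathcal S_c\times\mathcal S_c$. Then: (a) $\mathcal Q$ is nondegenerate. That is, the real coordinates, in any basis of $\mathcal S$, of the $\mathcal S$-valued form $Z\mapsto Z^2\bar Z^2$ are linearly independent over $\mathbb R$, and $\mathcal Q$ is of finite type at each of its points (the iterated Lie brackets of smooth sections of its complex tangent bundle span its tangent space); and $\mathcal Q$ is holomorphically nondegenerate at each of its points (there is no nonzero germ of a holomorphic vector field of type $(1,0)$ on $\mathcal S_c\times\mathcal S_c$ tangent to $\mathcal Q$). (b) $\mathcal Q$ satisfies the full-dimension condition (fd):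 the image of the map $\mathcal S_c\times\mathcal S_c\to\mathcal S_c$, $(Z,\zeta)\mapsto Z^2\zeta^2$, has interior points. (c) Let $\mathrm{aut}\,\mathcal Q$ be the Lie algebra of the fields $X=2\,\mathrm{Re}\big(f(Z,W)\frac{\partial}{\partial Z}+g(Z,W)\frac{\partial}{\partial W}\big)$ with $f,g$ holomorphic in a neighbourhood of the origin that are tangent to $\mathcal Q$ near the origin. Every field $X\in\mathrm{aut}\,\mathcal Q$ has, near the origin, the form $$X=2\,\mathrm{Re}\Big(\big(\lambda(Z)+B(W,Z)\big)\frac{\partial}{\partial Z}+\big(q+\rho(W)+r(W,W)\big)\frac{\partial}{\partial W}\Big),$$ where $q\in\mathcal S$, the maps $\lambda,\rho:\mathcal S_c\to\mathcal S_c$ are $\mathbb C$-linear, the maps $B,r:\mathcal S_c\times\mathcal S_c\to\mathcal S_c$ are $\mathbb C$-bilinear, $r$ is symmetric, $\rho(U)\in\mathcal S$ and $r(U,U)\in\mathcal S$ for $U\in\mathcal S$, and for all $Z\in\mathcal S_c$, $U\in\mathcal S$ $$4\,\mathrm{Re}\big(\lambda(Z)\,Z\bar Z^2\big)=\rho(Z^2\bar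 Z^2),\qquad 2\,\mathrm{Re}\big(B(U,Z)\,Z\bar Z^2\big)=r(U,Z^2\bar Z^2),\qquad \mathrm{Im}\big(B(Z^2\bar Z^2,Z)\,Z\bar Z^2\big)=0.$$ Conversely, every field of this form satisfying these relations belongs to $\mathrm{aut}\,\mathcal Q$. -/

import Mathlib

open scoped Topology ContDiff ComplexConjugate

noncomputable section

/-! ### The complexification of a real commutative algebra -/

/-- The complexification `S ⊕ i S` of a real commutative algebra `S`; an element is
`Z = X + i Y` with `X = Z.re` and `Y = Z.im` in `S`. -/
@[ext]
structure Cplx (S : Type*) where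
  re : S
  im : S

namespace Cplx

variable {S : Type*} [CommRing S]

/-- The inclusion of the real elements, `X ↦ X + i 0`. -/
def ofReal (x : S) : Cplx S := ⟨x, 0⟩

instance : Zero (Cplx S) := ⟨⟨0, 0⟩⟩
instance : One (Cplx S) := ⟨⟨1, 0⟩⟩
instance : Add (Cplx S) := ⟨fun a b => ⟨a.re + b.re, a.im + b.im⟩⟩
instance : Neg (Cplx S) := ⟨fun a => ⟨-a.re, -a.im⟩⟩
instance : Mul (Cplx S) :=
  ⟨fun a b => ⟨a.re * b.re - a.im * b.im, a.re * b.im + a.im * b.re⟩⟩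

@[simp] theorem ofReal_re (x : S) : (ofReal x).re = x := rfl
@[simp] theorem ofReal_im (x : S) : (ofReal x).im = 0 := rfl
@[simp] theorem zero_re : (0 : Cplx S).re = 0 := rfl
@[simp] theorem zero_im : (0 : Cplx S).im = 0 := rfl
@[simp] theorem one_re : (1 : Cplx S).re = 1 := rfl
@[simp] theorem one_im : (1 : Cplx S).im = 0 := rfl
@[simp] theorem add_re (a b : Cplx S) : (a + b).re = a.re + b.re := rfl
@[simp] theorem add_im (a b : Cplx S) : (a + b).im = a.im + b.im := rfl
@[simp] theorem neg_re (a : Cplx S) : (-a).re = -a.re := rfl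
@[simp] theorem neg_im (a : Cplx S) : (-a).im = -a.im := rfl
@[simp] theorem mul_re (a b : Cplx S) : (a * b).re = a.re * b.re - a.im * b.im := rfl
@[simp] theorem mul_im (a b : Cplx S) : (a * b).im = a.re * b.im + a.im * b.re := rfl

instance : CommRing (Cplx S) where
  add_assoc a b c := by ext <;> simp [add_assoc]
  zero_add a := by ext <;> simp
  add_zero a := by ext <;> simp
  add_comm a b := by ext <;> simp [add_comm]
  neg_add_cancel a := by ext <;> simp
  mul_assoc a b c := by ext <;> simp <;> ring
  one_mul a := by ext <;> simp
  mul_one a := by ext <;> simp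
  mul_comm a b := by ext <;> simp <;> ring
  left_distrib a b c := by ext <;> simp <;> ring
  right_distrib a b c := by ext <;> simp <;> ring
  zero_mul a := by ext <;> simp
  mul_zero a := by ext <;> simp
  nsmul := nsmulRec
  zsmul := zsmulRec

@[simp] theorem sub_re (a b : Cplx S) : (a - b).re = a.re - b.re := by
  rw [sub_eq_add_neg, add_re, neg_re, sub_eq_add_neg]
@[simp] theorem sub_im (a b : Cplx S) : (a - b).im = a.im - b.im := by
  rw [sub_eq_add_neg, add_im, neg_im, sub_eq_add_neg]

/-- Complex conjugation `X + i Y ↦ X - i Y`, written `conj Z`. -/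
instance : StarRing (Cplx S) where
  star a := ⟨a.re, -a.im⟩
  star_involutive a := by ext <;> simp
  star_mul a b := by ext <;> simp <;> ring
  star_add a b := by ext <;> simp; ring

@[simp] theorem conj_re (a : Cplx S) : (conj a).re = a.re := rfl
@[simp] theorem conj_im (a : Cplx S) : (conj a).im = -a.im := rfl

variable [Algebra ℝ S]

/-- The inclusion of the complex scalars, `x + i y ↦ x 1 + i (y 1)`. -/
def ofComplex : ℂ →+* Cplx S where
  toFun c := ⟨algebraMap ℝ S c.re, algebraMap ℝ S c.im⟩
  map_one' := by ext <;> simp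
  map_mul' a b := by ext <;> simp
  map_zero' := by ext <;> simp
  map_add' a b := by ext <;> simp

instance : Algebra ℂ (Cplx S) where
  smul c a := ⟨c.re • a.re - c.im • a.im, c.re • a.im + c.im • a.re⟩
  algebraMap := ofComplex
  commutes' a b := mul_comm _ _
  smul_def' c a := by
    change (⟨c.re • a.re - c.im • a.im, c.re • a.im + c.im • a.re⟩ : Cplx S) = _
    ext <;> simp [ofComplex, Algebra.smul_def]

@[simp] theorem smul_re (c : ℂ) (a : Cplx S) : (c • a).re = c.re • a.re - c.im • a.im := rfl
@[simp] theorem smul_im (c : ℂ) (a : Cplx S) : (c • a).im = c.re • a.im + c.im • a.re := rfl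

theorem real_smul_re (c : ℝ) (a : Cplx S) : (c • a).re = c • a.re := by
  change ((c : ℂ) • a).re = _
  rw [smul_re]
  simp

theorem real_smul_im (c : ℝ) (a : Cplx S) : (c • a).im = c • a.im := by
  change ((c : ℂ) • a).im = _
  rw [smul_im]
  simp

variable [FiniteDimensional ℝ S]

instance : FiniteDimensional ℂ (Cplx S) := by
  let e : (S × S) →ₗ[ℝ] Cplx S :=
    { toFun := fun p => ⟨p.1, p.2⟩
      map_add' := fun p q => rfl
      map_smul' := fun c p => by ext <;> simp [real_smul_re, real_smul_im] }
  have : Module.Finite ℝ (Cplx S) :=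
    Module.Finite.of_surjective e (fun a => ⟨(a.re, a.im), rfl⟩)
  exact Module.Finite.of_restrictScalars_finite ℝ ℂ (Cplx S)

/-- The realization of the complexified algebra by matrices (multiplication operators in a
basis). -/
def toMatrix : Cplx S →ₐ[ℂ] Matrix (Fin (Module.finrank ℂ (Cplx S)))
    (Fin (Module.finrank ℂ (Cplx S))) ℂ :=
  Algebra.leftMulMatrix (Module.finBasis ℂ (Cplx S))

section Norm

attribute [local instance] Matrix.linftyOpNormedRing Matrix.linftyOpNormedAlgebra

/-- A submultiplicative norm: the operator norm in the realization by matrices. All norms on this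
finite-dimensional space are equivalent, so that only its topology matters below. -/
instance : NormedCommRing (Cplx S) :=
  NormedCommRing.induced (Cplx S) _ (toMatrix (S := S))
    (Algebra.leftMulMatrix_injective (Module.finBasis ℂ (Cplx S)))

instance : NormedAlgebra ℂ (Cplx S) :=
  NormedAlgebra.induced ℂ (Cplx S) _ (toMatrix (S := S))

end Norm

end Cplx

/-! ### Real submanifolds of a complex vector space given by a defining function -/

section CR

variable {E F : Type*} [NormedAddCommGroup E] [NormedSpace ℂ E]
  [NormedAddCommGroup F] [NormedSpace ℝ F]

/-- The tangent space at `p` of the submanifold `{ρ = 0}`: the kernel of `dρ` at `p`. -/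
def tangentAt (ρ : E → F) (p : E) : Submodule ℝ E :=
  LinearMap.ker (fderiv ℝ ρ p : E →ₗ[ℝ] F)

/-- The vectors `v` such that `v` and `i v` are both tangent to `{ρ = 0}` at `p` (the complex
tangent space). Equivalently, the `(1,0)`-vector with components `v` annihilates `ρ`. -/
def complexTangentAt (ρ : E → F) (p : E) : Set E :=
  {v | v ∈ tangentAt ρ p ∧ Complex.I • v ∈ tangentAt ρ p}

/-- The holomorphic vector fields in a neighbourhood of the origin tangent to `{ρ = 0}`. The real
field `2 Re (∑ X_j ∂/∂z_j)` is, as a vector-valued map, the holomorphic map `X`; fields are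
regarded as germs at the origin. -/
def infAut (ρ : E → F) : Set (E → E) :=
  {X | AnalyticAt ℂ X 0 ∧ ∀ᶠ p in 𝓝 (0 : E), ρ p = 0 → X p ∈ tangentAt ρ p}

/-- Holomorphic nondegeneracy of `{ρ = 0}` at `p`: there is no nonzero germ at `p` of a
holomorphic `(1,0)`-field `∑ X_j ∂/∂z_j` tangent to `{ρ = 0}`. -/
def HolNondegenerateAt (ρ : E → F) (p : E) : Prop :=
  ∀ X : E → E, AnalyticAt ℂ X p →
    (∀ᶠ q in 𝓝 p, ρ q = 0 → X q ∈ complexTangentAt ρ q) → ∀ᶠ q in 𝓝 p, X q = 0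

/-- The iterated Lie brackets of smooth sections of the complex tangent bundle of `{ρ = 0}`
(extended smoothly to the ambient space). -/
inductive IsIteratedBracket (ρ : E → F) : (E → E) → Prop
  | of_section (V : E → E) (hV : ContDiff ℝ ∞ V)
      (hT : ∀ p, ρ p = 0 → V p ∈ complexTangentAt ρ p) : IsIteratedBracket ρ V
  | bracket (V W : E → E) (hV : IsIteratedBracket ρ V) (hW : IsIteratedBracket ρ W) :
      IsIteratedBracket ρ (VectorField.lieBracket ℝ V W)

/-- Finite type at `p`: the iterated brackets of sections of the complex tangent bundle span the
tangent space at `p`. -/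
def FiniteTypeAt (ρ : E → F) (p : E) : Prop :=
  tangentAt ρ p ≤ Submodule.span ℝ {v | ∃ V, IsIteratedBracket ρ V ∧ V p = v}

end CR

/-- The coordinates of a map `φ` into the finite-dimensional real space `S ≃ ℝ^l`, in any basis,
are linearly independent over `ℝ` as functions. -/
def CoordinatesIndependent {V S : Type*} [AddCommGroup S] [Module ℝ S] (φ : V → S) : Prop :=
  ∀ b : Module.Basis (Fin (Module.finrank ℝ S)) ℝ S,
    LinearIndependent ℝ (fun j => fun Z : V => b.repr (φ Z) j)

/-! ### Algebraization -/

/-- The `S`-algebraization of a polynomial `P(z, z̄)` on `ℂ^N`: the variables `z_j` (index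
`Sum.inl j`) and `z̄_j` (index `Sum.inr j`) are replaced by `Z_j` and its conjugate, where `Z_j`
is in the complexification of `S`. Here `P` is real-valued on `ℂ^N`. The algebraization of the
real algebraic set `{P = 0}` is the zero set of this map. -/
def algebraize (S : Type*) [CommRing S] [Algebra ℝ S] {N : ℕ}
    (P : MvPolynomial (Fin N ⊕ Fin N) ℂ) (Z : Fin N → Cplx S) : Cplx S :=
  MvPolynomial.aeval (Sum.elim Z (fun j => conj (Z j))) P

/-- The polynomial `Im w - z² z̄²` in `z, w, z̄, w̄`, where `z` has index `0` and `w` has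
index `1`. -/
def quarticPoly : MvPolynomial (Fin 2 ⊕ Fin 2) ℂ :=
  MvPolynomial.C (1 / (2 * Complex.I)) *
      (MvPolynomial.X (Sum.inl 1) - MvPolynomial.X (Sum.inr 1)) -
    MvPolynomial.X (Sum.inl 0) ^ 2 * MvPolynomial.X (Sum.inr 0) ^ 2

/-- The full-dimension condition `(fd)` for a form `Φ`: the image of `(z, ζ) ↦ Φ(z, z, ζ, ζ)` has
interior points. -/
def FullDimension {V V' : Type*} [TopologicalSpace V'] (Φ : V → V → V') : Prop :=
  (interior (Set.range (fun p : V × V => Φ p.1 p.2))).Nonempty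

section Quartic

variable (S : Type*) [CommRing S] [Algebra ℝ S]

/-- The defining function of the algebraization `𝒬` of `Im w = z² z̄²`, in the coordinates
`(Z, W)`. -/
def quarticFun (p : Cplx S × Cplx S) : Cplx S := algebraize S quarticPoly ![p.1, p.2]

/-- The algebraization `𝒬` of `Im w = z² z̄²`. -/
def quartic : Set (Cplx S × Cplx S) := {p | quarticFun S p = 0}

/-- The form `Φ(z, z, ζ, ζ) = z² ζ²` of the surface `Im W = Φ(Z, Z, Z̄, Z̄)`, with the conjugate
replaced by an independent variable. -/
def quarticForm (Z ζ : Cplx S) : Cplx S := Z ^ 2 * ζ ^ 2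

variable {S}

theorem quarticFun_eq (p : Cplx S × Cplx S) :
    quarticFun S p = Cplx.ofReal p.2.im - quarticForm S p.1 (conj p.1) := by
  have h : (1 / (2 * Complex.I)) = ⟨0, -1 / 2⟩ := by
    apply Complex.ext <;> simp
    norm_num
  have h2 : (MvPolynomial.aeval (Sum.elim ![p.1, p.2] fun j => conj (![p.1, p.2] j)))
      (MvPolynomial.C (σ := Fin 2 ⊕ Fin 2) (1 / (2 * Complex.I)) *
      (MvPolynomial.X (Sum.inl 1) - MvPolynomial.X (Sum.inr 1))) = Cplx.ofReal p.2.im := by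
    rw [h, ← MvPolynomial.smul_eq_C_mul, map_smul]
    ext
    · have h3 : p.2.im + p.2.im = (2 : ℝ) • p.2.im := (two_smul ℝ p.2.im).symm
      simp only [map_sub, MvPolynomial.aeval_X, Sum.elim_inl, Sum.elim_inr, Cplx.smul_re,
        Cplx.sub_im, Cplx.conj_im, Matrix.cons_val_one, Matrix.cons_val_fin_one, zero_smul,
        sub_neg_eq_add, h3, smul_smul, Cplx.ofReal_re]
      norm_num
    · simp
  simp only [quarticFun, algebraize, quarticPoly, quarticForm, map_sub, h2]
  simp

theorem mem_quartic_iff (p : Cplx S × Cplx S) :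
    p ∈ quartic S ↔ Cplx.ofReal p.2.im = p.1 ^ 2 * conj p.1 ^ 2 := by
  rw [quartic, Set.mem_ofPred_eq, quarticFun_eq, sub_eq_zero, quarticForm]

end Quartic

/-- The form is real on the diagonal, so that `Φ(Z, Z, Z̄, Z̄)` is the element
`(quarticForm S Z (conj Z)).re` of `S`. -/
theorem quarticForm_conj_im {S : Type*} [CommRing S] (Z : Cplx S) : (quarticForm S Z (conj Z)).im = 0 := by
  simp [quarticForm, pow_two]
  ring

end

/-! ### Identity theorems for holomorphic maps, and two elementary algebraic lemmas. -/

section General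

/-! Part (a) rests on explicit computations. Fourth powers span `S`, so no nonzero functional kills
the form. The sections of the complex tangent bundle with constant first component produce, after
three brackets, every constant real direction in `W`. A tangent `(1,0)`-field `(f, g)` satisfies `g
= 4i f Z ζ²` after `conj Z` is replaced by a free variable `ζ`; the second difference in `ζ` kills
`f Z`, and density of the units kills `f`. For (b), squaring is open near `1`.

For (c), tangency reads `Im g = 4 Re (f Z (conj Z)²)` on the quartic. Freeing `ζ = conj Z` gives the
holomorphic identity `Polarized` between `(f, g)` and the conjugate field `(f', g')`. Setting one of
`Z`, `ζ` to zero shows that `g` and `g'` are one function `G` of `W` alone (`Polarized.reduce`).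
Parity in `ζ` gives `f' (0, P) = 0` (`Polarized.eventually_zero`), and dividing by `ζ²` along `ζ = s
• 1` shows that `f Z` is linear in `Z²` (`Polarized.eventually_mul_eq`). Hence `f` is homogeneous of
degree one along unit directions `Z` (`eventually_smul_eq`).

With units `Z`, `ζ` fixed and `V = Z² ζ²`, scaling both by `u` with `2 κ u⁴ = x - y` turns the
identity into `h x - h y = 2 (x - y) (a x + b y)`. Its solutions have `a` affine and `h` quadratic
(`affine_of_functional_equation`, `Polarized.exists_affine`). The pairs `(Z, V)` obtained fill a
neighbourhood of `(1, 1)`, so the normal form holds on an open cone of lines and, by analyticity,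
near the origin (`Polarized.exists_normal_form`). The relations are then the coefficients of the
tangency condition in two real scaling parameters (`relations_of_eventually_tangent`). -/

theorem tendsto_zero_of_eq_zero {A B : Type*} [TopologicalSpace A] [TopologicalSpace B] [Zero B]
    {f : A → B} (hf : Continuous f) {a : A} (h : f a = 0) :
    Filter.Tendsto f (𝓝 a) (𝓝 0) := by
  have := hf.tendsto a
  rwa [h] at this

/-- A function of one complex variable on a convex open set which vanishes at the small reals
vanishes identically. -/
theorem eqOn_zero_of_eventually_real {G : Type*} [NormedAddCommGroup G] [NormedSpace ℂ G]
    [CompleteSpace G] {h : ℂ → G} {D : Set ℂ} (hD : IsOpen D) (hc : Convex ℝ D)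
    (h0 : (0 : ℂ) ∈ D) (hd : DifferentiableOn ℂ h D) (hz : ∀ᶠ s : ℝ in 𝓝 0, h s = 0) :
    Set.EqOn h 0 D := by
  refine (hd.analyticOnNhd hD).eqOn_zero_of_preconnected_of_frequently_eq_zero
    hc.isPreconnected h0 ?_
  have hz' : ∀ᶠ s : ℝ in 𝓝[≠] 0, h s = 0 := hz.filter_mono nhdsWithin_le_nhds
  have ht : Filter.Tendsto (fun s : ℝ => (s : ℂ)) (𝓝[≠] 0) (𝓝[≠] 0) := by
    refine tendsto_nhdsWithin_iff.2 ⟨?_, ?_⟩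
    · have : Filter.Tendsto (fun s : ℝ => (s : ℂ)) (𝓝 0) (𝓝 ((0 : ℝ) : ℂ)) :=
        Complex.continuous_ofReal.tendsto 0
      simpa using this.mono_left nhdsWithin_le_nhds
    · filter_upwards [self_mem_nhdsWithin] with s hs
      simpa using hs
  exact ht.frequently hz'.frequently

/-- A holomorphic function which vanishes at the real points near a real point vanishes near this
point. The projection to the real points is `re`. -/
theorem eventually_zero_of_eventually_real {E G : Type*} [NormedAddCommGroup E]
    [NormedSpace ℂ E] [NormedAddCommGroup G] [NormedSpace ℂ G] [CompleteSpace G]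
    (re : E →L[ℝ] E) (hre : ∀ v, re v + Complex.I • re (-Complex.I • v) = v)
    {H : E → G} {p : E} (hH : ∀ᶠ q in 𝓝 p, DifferentiableAt ℂ H q)
    (hz : ∀ᶠ v in 𝓝 (0 : E), H (p + re v) = 0) : ∀ᶠ q in 𝓝 p, H q = 0 := by
  obtain ⟨r, hr, hb⟩ := Metric.eventually_nhds_iff_ball.1 hH
  have hcont : Filter.Tendsto (fun v : E => p + re v) (𝓝 0) (𝓝 p) := by
    have : Continuous (fun v : E => p + re v) := by fun_prop
    simpa using this.tendsto 0
  have hadd : Filter.Tendsto (fun q : E => q - p) (𝓝 p) (𝓝 0) := by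
    have : Continuous (fun q : E => q - p) := by fun_prop
    simpa using this.tendsto p
  have h1 : ∀ᶠ v in 𝓝 (0 : E), p + re v ∈ Metric.ball p r :=
    hcont.eventually (Metric.ball_mem_nhds p hr)
  filter_upwards [hadd.eventually h1, hadd.eventually hz.eventually_nhds,
    Metric.ball_mem_nhds p hr] with q hq1 hq2 hq3
  set v := q - p with hv
  -- Real `s` gives points `p + re (v - s i v)`, where `H` vanishes for small `s`; the value `s = i`
  -- gives `q`.
  let l : ℂ → E := fun s => p + re v + s • re (-Complex.I • v)
  have hl : Continuous l := by fun_prop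
  have hIl : l Complex.I = q := by
    simp only [l, add_assoc, hre]
    simp [hv]
  have key := eqOn_zero_of_eventually_real (h := fun s => H (l s))
    (D := l ⁻¹' Metric.ball p r) (Metric.isOpen_ball.preimage hl) ?_ ?_ ?_ ?_
  · have := key (x := Complex.I) (by simpa [Set.mem_preimage, hIl] using hq3)
    simpa [hIl] using this
  · intro x hx y hy a b ha hb' hab
    have e : l (a • x + b • y) = a • l x + b • l y := by
      have : (a : ℝ) • (p + re v) + b • (p + re v) = p + re v := by
        rw [← add_smul, hab, one_smul]
      simp only [l, smul_add, add_smul, smul_assoc] at this ⊢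
      rw [← this]
      abel
    rw [Set.mem_preimage, e]
    exact convex_ball p r hx hy ha hb' hab
  · simpa [l] using hq1
  · intro s hs
    have hdl : DifferentiableAt ℂ l s := by fun_prop
    exact ((hb _ hs).comp s hdl).differentiableWithinAt
  · have ht : Filter.Tendsto (fun s : ℝ => v + s • (-Complex.I • v)) (𝓝 0) (𝓝 v) := by
      have : Continuous (fun s : ℝ => v + s • (-Complex.I • v)) := by fun_prop
      simpa using this.tendsto 0
    filter_upwards [ht.eventually hq2] with s hs
    simpa [l, map_add, add_assoc] using hs

/-- An analytic function which vanishes near the origin on each line of an open set of directions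
vanishes near the origin. -/
theorem eventually_zero_of_eventually_cone {E G : Type*} [NormedAddCommGroup E]
    [NormedSpace ℂ E] [NormedAddCommGroup G] [NormedSpace ℂ G] [CompleteSpace G]
    {H : E → G} (hH : AnalyticAt ℂ H 0) {v₀ : E}
    (hz : ∀ᶠ v in 𝓝 v₀, ∀ᶠ s : ℂ in 𝓝 0, H (s • v) = 0) : ∀ᶠ q in 𝓝 0, H q = 0 := by
  obtain ⟨r, hr, hb⟩ := Metric.eventually_nhds_iff_ball.1 hH.eventually_analyticAt
  have hlt : Filter.Tendsto (fun s : ℝ => (s : ℂ) • v₀) (𝓝[>] 0) (𝓝 0) := by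
    have : Continuous (fun s : ℝ => (s : ℂ) • v₀) := by fun_prop
    simpa using (this.tendsto 0).mono_left nhdsWithin_le_nhds
  -- It suffices to find one point of the ball near which `H` vanishes. Every point near `s₀ • v₀`
  -- lies on a line of the open set of directions.
  obtain ⟨s₀, hs₀, hpos⟩ :=
    ((hlt.eventually (Metric.ball_mem_nhds 0 hr)).and self_mem_nhdsWithin).exists
  have hs0 : (s₀ : ℂ) ≠ 0 := by
    have : (0 : ℝ) < s₀ := hpos
    exact_mod_cast this.ne'
  have hon : AnalyticOnNhd ℂ H (Metric.ball 0 r) := fun q hq => hb q hq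
  refine Filter.mem_of_superset (Metric.ball_mem_nhds 0 hr)
    (hon.eqOn_zero_of_preconnected_of_eventuallyEq_zero
      (convex_ball (0 : E) r).isPreconnected hs₀ ?_)
  have hback : Filter.Tendsto (fun q : E => (s₀ : ℂ)⁻¹ • q) (𝓝 ((s₀ : ℂ) • v₀)) (𝓝 v₀) := by
    have : Continuous (fun q : E => (s₀ : ℂ)⁻¹ • q) := by fun_prop
    have h := this.tendsto ((s₀ : ℂ) • v₀)
    rwa [inv_smul_smul₀ hs0] at h
  filter_upwards [hback.eventually hz, Metric.isOpen_ball.mem_nhds hs₀] with q hq hqr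
  set v := (s₀ : ℂ)⁻¹ • q with hv
  have hq' : (s₀ : ℂ) • v = q := by simp [hv, smul_smul, hs0]
  have hl : Continuous (fun s : ℂ => s • v) := by fun_prop
  have key := eqOn_zero_of_eventually_real (h := fun s : ℂ => H (s • v))
    (D := (fun s : ℂ => s • v) ⁻¹' Metric.ball 0 r) (Metric.isOpen_ball.preimage hl) ?_ ?_ ?_ ?_
  · have := key (x := (s₀ : ℂ)) (by simpa [Set.mem_preimage, hq'] using hqr)
    simpa [hq'] using this
  · intro x hx y hy a b ha hb' hab
    have e : (a • x + b • y) • v = a • (x • v) + b • (y • v) := by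
      simp only [add_smul, smul_assoc]
    rw [Set.mem_preimage, e]
    exact convex_ball (0 : E) r hx hy ha hb' hab
  · simpa using hr
  · intro s hs
    have hdl : DifferentiableAt ℂ (fun s : ℂ => s • v) s := by fun_prop
    exact ((hb _ hs).differentiableAt.comp s hdl).differentiableWithinAt
  · have := (Complex.continuous_ofReal.tendsto 0)
    rw [Complex.ofReal_zero] at this
    exact this.eventually hq

/-- The solutions of the functional equation `h x - h y = 2 (x - y) (a x + b y)`. -/
theorem affine_of_functional_equation {K G : Type*} [Field K] [CharZero K] [AddCommGroup G]
    [Module K G] {h a b : K → G} {D : Set K} (h0 : (0 : K) ∈ D)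
    (hab : ∀ x ∈ D, ∀ y ∈ D, h x - h y = (2 * (x - y)) • (a x + b y)) {x₁ : K} (hx₁ : x₁ ∈ D)
    (hne : x₁ ≠ 0) :
    ∃ c : G, ∀ x ∈ D, a x = a 0 + x • c ∧
      h x = h 0 + x • ((2 : K) • (a 0 + b 0)) + (x ^ 2) • ((2 : K) • c) := by
  -- Exchanging `x` and `y` only changes the sign of the left side, so `a x + b y` is symmetric and
  -- `a - b` is constant.
  have h1 : ∀ x ∈ D, ∀ y ∈ D, a x - b x = a y - b y := by
    intro x hx y hy
    by_cases hxy : x = y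
    · rw [hxy]
    have e : (2 * (x - y)) • (a x + b y - (a y + b x)) = 0 := by
      have e1 := hab x hx y hy
      have e2 := hab y hy x hx
      rw [smul_sub, ← e1, show (2 * (x - y)) • (a y + b x) = -((2 * (y - x)) • (a y + b x)) by
        rw [← neg_smul]; congr 1; ring, ← e2]
      abel
    have := (smul_eq_zero.1 e).resolve_left (by simpa [sub_eq_zero] using hxy)
    rwa [sub_eq_zero, ← sub_eq_sub_iff_add_eq_add] at this
  -- Additivity of the differences of `h` over `x, 0, y` forces `a - a 0` to be proportional to the
  -- variable.
  have h2 : ∀ x ∈ D, ∀ y ∈ D, x • (a y - a 0) = y • (a x - a 0) := by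
    intro x hx y hy
    have e1 := hab x hx y hy
    have e2 := hab x hx 0 h0
    have e3 := hab y hy 0 h0
    have e4 : b y = a y - a 0 + b 0 := by
      have := h1 y hy 0 h0
      rw [sub_eq_iff_eq_add] at this
      rw [this]; abel
    rw [e4] at e1
    have e5 : (2 : K) • (x • (a y - a 0) - y • (a x - a 0)) = 0 := by
      have : h x - h y = (h x - h 0) - (h y - h 0) := by abel
      rw [e1, e2, e3] at this
      rw [← sub_eq_zero] at this
      rw [← this]
      module
    have := (smul_eq_zero.1 e5).resolve_left two_ne_zero
    exact sub_eq_zero.1 this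
  refine ⟨x₁⁻¹ • (a x₁ - a 0), fun x hx => ?_⟩
  have e : a x = a 0 + x • x₁⁻¹ • (a x₁ - a 0) := by
    rw [smul_comm, ← h2 x₁ hx₁ x hx, smul_smul, inv_mul_cancel₀ hne, one_smul]
    abel
  refine ⟨e, ?_⟩
  have e2 := hab x hx 0 h0
  rw [sub_eq_iff_eq_add] at e2
  rw [e2, e]
  module

/-- A quadratic polynomial with coefficients in a real vector space vanishing at small positive
numbers is zero. -/
theorem quadratic_coeff_eq_zero {M : Type*} [AddCommGroup M] [Module ℝ M] {a b c : M}
    (h : ∀ᶠ t : ℝ in 𝓝[>] 0, a + t • b + t ^ 2 • c = 0) : a = 0 ∧ b = 0 ∧ c = 0 := by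
  obtain ⟨u, hu, hsub⟩ := mem_nhdsGT_iff_exists_Ioo_subset.1 h
  have hu : (0 : ℝ) < u := hu
  have e : ∀ k : ℝ, 0 < k → k < 1 → a + (k * u) • b + (k * u) ^ 2 • c = 0 := fun k hk hk1 =>
    hsub ⟨by positivity, by nlinarith⟩
  have e1 := e (1 / 4) (by norm_num) (by norm_num)
  have e2 := e (2 / 4) (by norm_num) (by norm_num)
  have e3 := e (3 / 4) (by norm_num) (by norm_num)
  have hc : c = 0 := by
    have : (u ^ 2 / 8) • c = 0 := by
      have : (a + ((3 / 4) * u) • b + ((3 / 4) * u) ^ 2 • c) -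
        (2 : ℝ) • (a + ((2 / 4) * u) • b + ((2 / 4) * u) ^ 2 • c) +
        (a + ((1 / 4) * u) • b + ((1 / 4) * u) ^ 2 • c) = 0 := by rw [e1, e2, e3]; simp
      rw [← this]
      module
    exact (smul_eq_zero.1 this).resolve_left (by positivity)
  subst hc
  have hb : b = 0 := by
    have : (u / 4) • b = 0 := by
      have : (a + ((2 / 4) * u) • b + ((2 / 4) * u) ^ 2 • (0 : M)) -
        (a + ((1 / 4) * u) • b + ((1 / 4) * u) ^ 2 • (0 : M)) = 0 := by rw [e1, e2]; simp
      rw [← this]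
      module
    exact (smul_eq_zero.1 this).resolve_left (by positivity)
  subst hb
  exact ⟨by simpa using e1, rfl, rfl⟩

end General

noncomputable section

/-! ### Conjugation, square roots and units in the complexified algebra. -/

namespace Cplx

section Algebraic
variable {S : Type*} [CommRing S]

theorem conj_ofReal (x : S) : conj (ofReal x) = ofReal x := by ext <;> simp

theorem eq_ofReal_re {a : Cplx S} (h : a.im = 0) : a = ofReal a.re := by ext <;> simp [h]

theorem ofReal_injective : Function.Injective (ofReal : S → Cplx S) := fun _ _ h =>
  congrArg re h

theorem conj_conj (a : Cplx S) : conj (conj a) = a := star_star a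

variable [Algebra ℝ S]

theorem conj_smul (c : ℂ) (a : Cplx S) : conj (c • a) = conj c • conj a := by
  ext <;> simp
  abel

theorem add_conj (a : Cplx S) : a + conj a = (2 : ℂ) • ofReal a.re := by
  ext <;> simp [two_smul]

theorem sub_conj (a : Cplx S) : a - conj a = (2 * Complex.I) • ofReal a.im := by
  ext <;> simp [two_smul]

theorem I_smul_re (a : Cplx S) : (Complex.I • a).re = -a.im := by simp
end Algebraic

section Analytic

variable {S : Type*} [CommRing S] [Algebra ℝ S] [FiniteDimensional ℝ S]

instance : CompleteSpace (Cplx S) := FiniteDimensional.complete ℂ (Cplx S)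

instance : FiniteDimensional ℝ (Cplx S) := FiniteDimensional.complexToReal (Cplx S)

/-- Conjugation as a continuous real linear map. -/
def conjCLM : Cplx S →L[ℝ] Cplx S :=
  LinearMap.toContinuousLinearMap
    { toFun := fun a => conj a
      map_add' := fun a b => map_add _ a b
      map_smul' := fun c a => by
        change conj ((c : ℂ) • a) = (c : ℂ) • conj a
        rw [conj_smul, Complex.conj_ofReal] }

@[simp] theorem conjCLM_apply (a : Cplx S) : conjCLM a = conj a := rfl

theorem continuous_conj : Continuous (fun a : Cplx S => conj a) := conjCLM.continuous

/-- The `S`-imaginary part as a continuous real linear map. -/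
def imCLM : Cplx S →L[ℝ] Cplx S :=
  LinearMap.toContinuousLinearMap
    { toFun := fun a => ofReal a.im
      map_add' := fun a b => by ext <;> simp
      map_smul' := fun c a => by ext <;> simp [real_smul_re, real_smul_im] }

@[simp] theorem imCLM_apply (a : Cplx S) : imCLM a = ofReal a.im := rfl

/-- The function `z ↦ conj (f (conj z))` is holomorphic. -/
theorem differentiableAt_conj_comp {E : Type*} [NormedAddCommGroup E] [NormedSpace ℂ E]
    (c : E →L[ℝ] E) (hc : ∀ (t : ℂ) v, c (t • v) = conj t • c v) {f : E → Cplx S} {p : E}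
    (hf : DifferentiableAt ℂ f (c p)) : DifferentiableAt ℂ (fun z => conj (f (c z))) p := by
  let L := fderiv ℂ f (c p)
  have h1 : HasFDerivAt (fun z => conj (f (c z)))
      (conjCLM.comp ((L.restrictScalars ℝ).comp c)) p :=
    (conjCLM (S := S)).hasFDerivAt.comp p
      ((hf.hasFDerivAt.restrictScalars ℝ).comp p c.hasFDerivAt)
  -- The two conjugations cancel, so the real derivative is complex linear.
  let M : E →L[ℂ] Cplx S :=
    { toFun := fun z => conj (L (c z))
      map_add' := fun a b => by simp
      map_smul' := fun t a => by
        simp [hc, conj_smul]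
      cont := continuous_conj.comp (L.continuous.comp c.continuous) }
  exact (hasFDerivAt_of_restrictScalars ℝ h1 (f' := M) (by ext v <;> rfl)).differentiableAt

/-- The derivative of squaring at `1` is multiplication by `2`, which is surjective, so squaring
maps neighbourhoods of `1` onto neighbourhoods of `1`. -/
theorem eventually_exists_sq : ∀ᶠ z in 𝓝 (1 : Cplx S), ∃ y : Cplx S, y ^ 2 = z := by
  have h := (hasStrictFDerivAt_id (𝕜 := ℂ) (1 : Cplx S)).mul (hasStrictFDerivAt_id (1 : Cplx S))
  have hs : LinearMap.range (((id (1 : Cplx S)) • ContinuousLinearMap.id ℂ (Cplx S) +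
      (id (1 : Cplx S)) • ContinuousLinearMap.id ℂ (Cplx S) : Cplx S →L[ℂ] Cplx S) :
        Cplx S →ₗ[ℂ] Cplx S) = ⊤ := by
    rw [LinearMap.range_eq_top]
    intro z
    refine ⟨(2⁻¹ : ℂ) • z, ?_⟩
    change (1 : Cplx S) * ((2⁻¹ : ℂ) • z) + (1 : Cplx S) * ((2⁻¹ : ℂ) • z) = z
    rw [one_mul, ← add_smul]
    norm_num
  have := h.map_nhds_eq_of_surj hs
  simp only [Pi.mul_apply, id, one_mul] at this
  rw [← this, Filter.eventually_map]
  exact Filter.Eventually.of_forall fun y => ⟨y, pow_two y⟩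

/-- Multiplication by `-z` has finitely many eigenvalues, and an element acting bijectively is a
unit. This makes the units dense. -/
theorem eventually_isUnit_add_smul (z : Cplx S) :
    ∀ᶠ t : ℂ in 𝓝[≠] 0, IsUnit (z + t • (1 : Cplx S)) := by
  have hfin : (spectrum ℂ (-z)).Finite := by
    refine (Module.End.finite_spectrum (Algebra.lmul ℂ (Cplx S) (-z))).subset fun t ht => ?_
    rw [spectrum.mem_iff] at ht ⊢
    refine fun hu => ht ?_
    rw [← AlgHom.commutes (Algebra.lmul ℂ (Cplx S)), ← map_sub] at hu
    obtain ⟨y, hy⟩ := ((Module.End.isUnit_iff _).1 hu).2 1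
    exact IsUnit.of_mul_eq_one y hy
  have h : ∀ᶠ t : ℂ in 𝓝[≠] 0, t ∉ spectrum ℂ (-z) \ {0} := by
    have : ((spectrum ℂ (-z) \ {0} : Set ℂ))ᶜ ∈ 𝓝 (0 : ℂ) :=
      (hfin.subset Set.sdiff_subset).isClosed.isOpen_compl.mem_nhds (by simp)
    exact nhdsWithin_le_nhds this
  filter_upwards [h, self_mem_nhdsWithin] with t ht ht0
  have : t ∉ spectrum ℂ (-z) := fun h => ht ⟨h, ht0⟩
  rw [spectrum.notMem_iff] at this
  rwa [sub_neg_eq_add, Algebra.algebraMap_eq_smul_one, add_comm] at this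

end Analytic

end Cplx

open Cplx

/-! ### The tangent spaces of the quartic. -/

section Tangent

variable {S : Type*} [CommRing S] [Algebra ℝ S]

theorem mem_quartic_iff_im (p : Cplx S × Cplx S) :
    p ∈ quartic S ↔ p.2.im = (p.1 ^ 2 * conj p.1 ^ 2).re := by
  rw [mem_quartic_iff, Cplx.ext_iff]
  have : (p.1 ^ 2 * conj p.1 ^ 2).im = 0 := quarticForm_conj_im p.1
  simp [this]

variable [FiniteDimensional ℝ S]

theorem hasFDerivAt_quarticFun (p : Cplx S × Cplx S) : ∃ D : Cplx S × Cplx S →L[ℝ] Cplx S,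
    HasFDerivAt (quarticFun S) D p ∧ ∀ v, D v =
      ofReal v.2.im - (2 * p.1 * v.1 * conj p.1 ^ 2 + p.1 ^ 2 * (2 * conj p.1 * conj v.1)) := by
  have h1 : HasFDerivAt (fun p : Cplx S × Cplx S => p.1)
    (ContinuousLinearMap.fst ℝ (Cplx S) (Cplx S)) p := hasFDerivAt_fst
  have h2 : HasFDerivAt (fun p : Cplx S × Cplx S => p.2)
    (ContinuousLinearMap.snd ℝ (Cplx S) (Cplx S)) p := hasFDerivAt_snd
  have h3 := (conjCLM (S := S)).hasFDerivAt.comp p h1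
  have h4 := (imCLM (S := S)).hasFDerivAt.comp p h2
  have h5 := h4.sub ((h1.mul h1).mul (h3.mul h3))
  refine ⟨_, h5.congr_of_eventuallyEq (Filter.Eventually.of_forall fun q => ?_), fun v => ?_⟩
  · simp only [quarticFun_eq, quarticForm, pow_two]
    rfl
  · simp
    ring

theorem mem_tangentAt_iff (p v : Cplx S × Cplx S) : v ∈ tangentAt (quarticFun S) p ↔
    v.2.im = (4 : ℝ) • (v.1 * p.1 * conj p.1 ^ 2).re := by
  obtain ⟨D, hD, hv⟩ := hasFDerivAt_quarticFun p
  have e : 2 * p.1 * v.1 * conj p.1 ^ 2 + p.1 ^ 2 * (2 * conj p.1 * conj v.1) =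
      ofReal ((4 : ℝ) • (v.1 * p.1 * conj p.1 ^ 2).re) := by
    have := add_conj (v.1 * p.1 * conj p.1 ^ 2)
    have h2 : (2 : Cplx S) * (v.1 * p.1 * conj p.1 ^ 2 + conj (v.1 * p.1 * conj p.1 ^ 2)) =
        ofReal ((4 : ℝ) • (v.1 * p.1 * conj p.1 ^ 2).re) := by
      rw [this, two_mul]
      ext
      · simp only [add_re, smul_re, ofReal_re, ofReal_im]
        simp
        rw [← add_smul]; norm_num
      · simp
    rw [← h2]
    simp
    ring
  rw [tangentAt, LinearMap.mem_ker, hD.fderiv]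
  change D v = 0 ↔ _
  rw [hv, e, sub_eq_zero]
  exact ofReal_injective.eq_iff

/-- Tangency of `v` and of `i v` are the imaginary and the real part of a single equation over `Cplx
S`. -/
theorem mem_complexTangentAt_iff (p v : Cplx S × Cplx S) :
    v ∈ complexTangentAt (quarticFun S) p ↔
      v.2 = (4 * Complex.I) • (v.1 * p.1 * conj p.1 ^ 2) := by
  have h : (Complex.I • v).1 * p.1 * conj p.1 ^ 2 =
      Complex.I • (v.1 * p.1 * conj p.1 ^ 2) := by
    simp
  have h2 : (Complex.I • v).2.im = v.2.re := by simp
  rw [complexTangentAt, Set.mem_ofPred_eq, mem_tangentAt_iff, mem_tangentAt_iff, h, h2, I_smul_re,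
    Cplx.ext_iff, and_comm]
  refine and_congr ?_ ?_ <;> simp

end Tangent

/-! ### Independence of the coordinates and the full-dimension condition. -/

section Nondegenerate

/-- Fourth powers span `S`: the odd part of `(1 + y)⁴` is `4 y + 4 y³`, and comparing `y` with `2 y`
eliminates the cubic term. -/
theorem eq_zero_of_forall_pow_four {S : Type*} [CommRing S] [Algebra ℝ S] (l : S →ₗ[ℝ] ℝ)
    (h : ∀ x : S, l (x ^ 4) = 0) : l = 0 := by
  ext y
  have e : (48 : ℝ) • y = (8 : ℝ) • ((1 + y) ^ 4 - (1 - y) ^ 4) -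
      ((1 + (2 : ℝ) • y) ^ 4 - (1 - (2 : ℝ) • y) ^ 4) := by
    have e1 : ∀ z : S, (2 : ℝ) • z = 2 * z := fun z => by rw [two_smul, two_mul]
    have e2 : ∀ z : S, (8 : ℝ) • z = 8 * z := fun z => by
      rw [Algebra.smul_def, map_ofNat]
    have e3 : ∀ z : S, (48 : ℝ) • z = 48 * z := fun z => by
      rw [Algebra.smul_def, map_ofNat]
    rw [e1, e2, e3]
    ring
  have h2 : l ((48 : ℝ) • y) = 0 := by
    rw [e]
    simp [h]
  rw [map_smul, smul_eq_mul] at h2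
  simpa using h2

theorem coordinatesIndependent_quarticForm (S : Type*) [CommRing S] [Algebra ℝ S]
    [FiniteDimensional ℝ S] :
    CoordinatesIndependent (fun Z : Cplx S => (quarticForm S Z (conj Z)).re) := by
  intro b
  rw [Fintype.linearIndependent_iff]
  intro g hg i
  let l : S →ₗ[ℝ] ℝ := ∑ j, g j • b.coord j
  have hl : l = 0 := by
    apply eq_zero_of_forall_pow_four
    intro x
    have h := congrFun hg (ofReal x)
    have e : (quarticForm S (ofReal x) (conj (ofReal x))).re = x ^ 4 := by
      simp [quarticForm, pow_two]
      ring
    simpa [l, e] using h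
  have := congrArg (fun m : S →ₗ[ℝ] ℝ => m (b i)) hl
  simpa [l, Finsupp.single_apply] using this

/-- Already with `ζ = 1` the image contains all squares, hence a neighbourhood of `1`. -/
theorem fullDimension_quarticForm (S : Type*) [CommRing S] [Algebra ℝ S]
    [FiniteDimensional ℝ S] : FullDimension (quarticForm S) := by
  refine ⟨1, mem_interior_iff_mem_nhds.2 ?_⟩
  filter_upwards [eventually_exists_sq (S := S)] with z hz
  obtain ⟨y, rfl⟩ := hz
  exact ⟨(y, 1), by simp [quarticForm]⟩

end Nondegenerate

/-! ### Finite type. -/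

section FiniteType

variable {S : Type*} [CommRing S] [Algebra ℝ S] [FiniteDimensional ℝ S]

theorem lieBracket_const_prod {A : Type*} [NormedAddCommGroup A] [NormedSpace ℝ A] {c d : A}
    {k m : A → A} {k' m' : A → A →L[ℝ] A} (hk : ∀ z, HasFDerivAt k (k' z) z)
    (hm : ∀ z, HasFDerivAt m (m' z) z) :
    VectorField.lieBracket ℝ (fun p : A × A => (c, k p.1)) (fun p => (d, m p.1)) =
      fun p => (0, m' p.1 c - k' p.1 d) := by
  have key : ∀ {d : A} {m : A → A} {m' : A → A →L[ℝ] A}, (∀ z, HasFDerivAt m (m' z) z) →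
      ∀ p v : A × A, fderiv ℝ (fun p : A × A => (d, m p.1)) p v = (0, m' p.1 v.1) := by
    intro d m m' hm p v
    have h := (hasFDerivAt_const d p).prodMk ((hm p.1).comp p hasFDerivAt_fst)
    have e : (fun p : A × A => (d, m p.1)) = fun p : A × A => (d, (m ∘ Prod.fst) p) := rfl
    rw [e, h.fderiv]
    simp
  ext1 p
  rw [VectorField.lieBracket, key hm, key hk]
  simp

/-- The second component of the section of the complex tangent bundle with first component `c`. -/
def sectionComp (c z : Cplx S) : Cplx S := (4 * Complex.I) • (c * z * conj z ^ 2)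

theorem hasFDerivAt_sectionComp (c z : Cplx S) : ∃ D : Cplx S →L[ℝ] Cplx S,
    HasFDerivAt (sectionComp c) D z ∧ ∀ e, D e =
      (4 * Complex.I) • (c * (e * conj z ^ 2 + 2 * z * conj z * conj e)) := by
  have h1 : HasFDerivAt (fun z : Cplx S => z) (ContinuousLinearMap.id ℝ (Cplx S)) z :=
    hasFDerivAt_id z
  have h2 := (conjCLM (S := S)).hasFDerivAt (x := z)
  have h3 := (((h1.const_mul c).mul (h2.mul h2))).const_smul (4 * Complex.I)
  refine ⟨_, h3.congr_of_eventuallyEq (Filter.Eventually.of_forall fun q => ?_), fun e => ?_⟩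
  · simp only [sectionComp, pow_two]
    rfl
  · simp [Algebra.smul_def]
    ring

theorem contDiff_section (c : Cplx S) :
    ContDiff ℝ ∞ (fun p : Cplx S × Cplx S => (c, sectionComp c p.1)) := by
  have h : ContDiff ℝ ∞ (fun p : Cplx S × Cplx S => conjCLM p.1) :=
    (conjCLM (S := S)).contDiff.comp contDiff_fst
  have h2 : ContDiff ℝ ∞ (fun p : Cplx S × Cplx S =>
      (4 * Complex.I) • (c * p.1 * (conjCLM p.1) ^ 2)) :=
    ((contDiff_const.mul contDiff_fst).mul (h.pow 2)).const_smul _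
  exact contDiff_const.prodMk h2

theorem isIteratedBracket_section (c : Cplx S) :
    IsIteratedBracket (quarticFun S) (fun p => (c, sectionComp c p.1)) :=
  .of_section _ (contDiff_section c) fun p _ => (mem_complexTangentAt_iff p _).2 rfl

/-- The second components produced by the successive brackets are `16 c z (conj z)`, `16 c (z + conj
z)` and `32 c`: after the first bracket, bracketing with the section of first component `1` is
differentiation in the direction `1`. -/
theorem isIteratedBracket_const (c : S) :
    IsIteratedBracket (quarticFun S) (fun _ => (0, 32 * ofReal c)) := by
  choose D hD hDe using fun c z : Cplx S => hasFDerivAt_sectionComp c z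
  have hconj := fun z => (conjCLM (S := S)).hasFDerivAt (x := z)
  have hid : ∀ z : Cplx S, HasFDerivAt (fun z : Cplx S => z)
    (ContinuousLinearMap.id ℝ (Cplx S)) z := hasFDerivAt_id
  have h1 := IsIteratedBracket.bracket _ _
    (isIteratedBracket_section (Complex.I • ofReal c)) (isIteratedBracket_section 1)
  rw [lieBracket_const_prod (hD _) (hD _)] at h1
  have e1 : (fun p : Cplx S × Cplx S => ((0 : Cplx S),
      (D 1 p.1) (Complex.I • ofReal c) - (D (Complex.I • ofReal c) p.1) 1)) =
      fun p => (0, 16 * ofReal c * (p.1 * conjCLM p.1)) := by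
    ext1 p
    rw [hDe, hDe, conj_smul, conj_ofReal, ← smul_sub]
    congr 1
    have : (1 : Cplx S) * (Complex.I • ofReal c * conj p.1 ^ 2 +
        2 * p.1 * conj p.1 * conj Complex.I • ofReal c) -
        Complex.I • ofReal c * (1 * conj p.1 ^ 2 + 2 * p.1 * conj p.1 * conj 1) =
        (-4 * Complex.I) • (ofReal c * (p.1 * conj p.1)) := by
      simp only [Complex.conj_I, map_one, Algebra.smul_def, map_neg, map_mul, map_ofNat]
      ring
    rw [this, smul_smul]
    have : 4 * Complex.I * (-4 * Complex.I) = 16 := by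
      ring_nf; simp
    rw [this, Algebra.smul_def, map_ofNat, conjCLM_apply]
    ring
  rw [e1] at h1
  have h2 := IsIteratedBracket.bracket _ _ (isIteratedBracket_section 1) h1
  have hm : ∀ z : Cplx S, HasFDerivAt (fun z : Cplx S => 16 * ofReal c * (z * conjCLM z)) _ z :=
    fun z => ((hid z).mul (hconj z)).const_mul (16 * ofReal c)
  rw [lieBracket_const_prod (hD _) hm] at h2
  have e2 : (fun p : Cplx S × Cplx S => ((0 : Cplx S),
      ((16 * ofReal c) • (p.1 • conjCLM + conjCLM p.1 • ContinuousLinearMap.id ℝ (Cplx S)) :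
        Cplx S →L[ℝ] Cplx S) 1 - (D 1 p.1) 0)) =
      fun p => (0, 16 * ofReal c * (p.1 + conjCLM p.1)) := by
    ext1 p
    simp [mul_add]
  rw [e2] at h2
  have h3 := IsIteratedBracket.bracket _ _ (isIteratedBracket_section 1) h2
  have hn : ∀ z : Cplx S, HasFDerivAt (fun z : Cplx S => 16 * ofReal c * (z + conjCLM z)) _ z :=
    fun z => ((hid z).add (hconj z)).const_mul (16 * ofReal c)
  rw [lieBracket_const_prod (hD _) hn] at h3
  convert h3 using 1
  ext1 p
  simp
  ring

theorem finiteTypeAt_quarticFun (p : Cplx S × Cplx S) : FiniteTypeAt (quarticFun S) p := by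
  intro v hv
  rw [mem_tangentAt_iff] at hv
  have him : (v.2 - sectionComp v.1 p.1).im = 0 := by
    rw [sub_im, hv, sectionComp]
    simp
  -- Subtracting the section with the same first component leaves a real vector in the `W`
  -- direction.
  have e : v = (v.1, sectionComp v.1 p.1) +
      (0, 32 * ofReal ((32⁻¹ : ℝ) • (v.2 - sectionComp v.1 p.1).re)) := by
    have e1 : (32 : Cplx S) * ofReal ((32⁻¹ : ℝ) • (v.2 - sectionComp v.1 p.1).re) =
        v.2 - sectionComp v.1 p.1 := by
      have e2 : ∀ a : Cplx S, 32 * a = (32 : ℂ) • a := fun a => by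
        rw [Algebra.smul_def, map_ofNat]
      rw [e2, eq_ofReal_re him]
      ext <;> simp [smul_smul]
    rw [e1]
    ext1 <;> simp
  rw [e]
  exact add_mem (Submodule.subset_span ⟨_, isIteratedBracket_section v.1, rfl⟩)
    (Submodule.subset_span ⟨_, isIteratedBracket_const _, rfl⟩)

end FiniteType

/-! ### The totally real subspace `ζ = conj Z`, `W` real. -/

section Polarization

variable {S : Type*} [CommRing S] [Algebra ℝ S] [FiniteDimensional ℝ S]

/-- The projection of `(Z, ζ, W)` to the real points `ζ = conj Z`, `W ∈ S`. -/
def polarRe : Cplx S × Cplx S × Cplx S →L[ℝ] Cplx S × Cplx S × Cplx S :=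
  LinearMap.toContinuousLinearMap
    { toFun := fun v => (2⁻¹ : ℂ) • (v.1 + conj v.2.1, v.2.1 + conj v.1, v.2.2 + conj v.2.2)
      map_add' := fun v w => by
        rw [← smul_add]
        congr 1
        simp only [Prod.fst_add, Prod.snd_add, map_add, Prod.mk_add_mk]
        refine Prod.ext ?_ (Prod.ext ?_ ?_) <;> simp <;> abel
      map_smul' := fun c v => by
        change (2⁻¹ : ℂ) • (((c : ℂ) • v).1 + conj ((c : ℂ) • v).2.1, ((c : ℂ) • v).2.1 +
          conj ((c : ℂ) • v).1, ((c : ℂ) • v).2.2 + conj ((c : ℂ) • v).2.2) =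
          (c : ℂ) • (2⁻¹ : ℂ) • (v.1 + conj v.2.1, v.2.1 + conj v.1, v.2.2 + conj v.2.2)
        rw [smul_comm]
        congr 1
        have h : ∀ a : Cplx S, conj (c • a) = c • conj a := (conjCLM (S := S)).map_smul c
        refine Prod.ext ?_ (Prod.ext ?_ ?_) <;> simp [h, smul_add] }

theorem polarRe_apply (v : Cplx S × Cplx S × Cplx S) :
    polarRe v = (2⁻¹ : ℂ) • (v.1 + conj v.2.1, v.2.1 + conj v.1, v.2.2 + conj v.2.2) := rfl

theorem polarRe_add (v : Cplx S × Cplx S × Cplx S) :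
    polarRe v + Complex.I • polarRe (-Complex.I • v) = v := by
  have key : ∀ a b : Cplx S, (2⁻¹ : ℂ) • (a + b) +
      Complex.I • (2⁻¹ : ℂ) • (-(Complex.I • a) + Complex.I • b) = a := by
    intro a b
    have h : (2⁻¹ : ℂ) • (a + b) + Complex.I • (2⁻¹ : ℂ) • (-(Complex.I • a) + Complex.I • b) =
      (2⁻¹ - Complex.I * Complex.I * 2⁻¹) • a + (2⁻¹ + Complex.I * Complex.I * 2⁻¹) • b := by
      module
    rw [h, Complex.I_mul_I]
    norm_num
  rw [polarRe_apply, polarRe_apply]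
  refine Prod.ext ?_ (Prod.ext ?_ ?_) <;> simp [conj_smul, -smul_add, key]

theorem conj_polarRe_fst (v : Cplx S × Cplx S × Cplx S) :
    conj (polarRe v).1 = (polarRe v).2.1 := by
  simp [polarRe_apply, conj_smul, add_comm, map_ofNat]

theorem conj_polarRe_snd (v : Cplx S × Cplx S × Cplx S) :
    conj (polarRe v).2.2 = (polarRe v).2.2 := by
  simp [polarRe_apply, conj_smul, add_comm, map_ofNat]

end Polarization

/-! ### Holomorphic nondegeneracy. -/

section HolNondegenerate

variable {S : Type*} [CommRing S] [Algebra ℝ S]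

theorem im_eq_zero_of_conj_eq {a : Cplx S} (h : conj a = a) : a.im = 0 := by
  have h2 : -a.im = a.im := congrArg Cplx.im h
  have : (2 : ℝ) • a.im = 0 := by
    rw [two_smul]
    nth_rewrite 1 [← h2]
    simp
  exact (smul_eq_zero.1 this).resolve_left two_ne_zero

/-- The point of the quartic with coordinates `Z` and `Re W = U`. -/
theorem mem_quartic_of_conj_eq {Z ζ U : Cplx S} (hζ : conj Z = ζ) (hU : conj U = U) :
    (Z, U + Complex.I • (Z ^ 2 * ζ ^ 2)) ∈ quartic S := by
  subst hζ
  rw [mem_quartic_iff_im]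
  simp [im_eq_zero_of_conj_eq hU]

variable [FiniteDimensional ℝ S]

theorem holNondegenerateAt_quarticFun {p : Cplx S × Cplx S} (hp : p ∈ quartic S) :
    HolNondegenerateAt (quarticFun S) p := by
  intro X hX hT
  obtain ⟨Z₀, W₀⟩ := p
  set U₀ : Cplx S := W₀ - Complex.I • (Z₀ ^ 2 * conj Z₀ ^ 2) with hU₀
  have hU₀c : conj U₀ = U₀ := by
    rw [mem_quartic_iff] at hp
    rw [hU₀, ← hp]
    ext <;> simp
  let m : Cplx S × Cplx S × Cplx S → Cplx S × Cplx S :=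
    fun v => (v.1, v.2.2 + Complex.I • (v.1 ^ 2 * v.2.1 ^ 2))
  have hm : Differentiable ℂ m := by fun_prop
  have hm0 : m (Z₀, conj Z₀, U₀) = (Z₀, W₀) := by simp [m, hU₀]
  -- The complex tangency equation with `conj Z` replaced by the free variable `ζ`; it holds on the
  -- real points, hence near the base point.
  let H : Cplx S × Cplx S × Cplx S → Cplx S :=
    fun v => (X (m v)).2 - (4 * Complex.I) • ((X (m v)).1 * v.1 * v.2.1 ^ 2)
  have hmt : Filter.Tendsto m (𝓝 (Z₀, conj Z₀, U₀)) (𝓝 (Z₀, W₀)) := by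
    rw [← hm0]
    exact hm.continuous.tendsto _
  have hHd : ∀ᶠ v in 𝓝 (Z₀, conj Z₀, U₀), DifferentiableAt ℂ H v := by
    filter_upwards [hmt.eventually hX.eventually_analyticAt] with v hv
    have h1 : DifferentiableAt ℂ (fun v => X (m v)) v :=
      hv.differentiableAt.comp v (hm v)
    fun_prop
  have hre : Filter.Tendsto (fun v => (Z₀, conj Z₀, U₀) + polarRe v) (𝓝 0)
      (𝓝 (Z₀, conj Z₀, U₀)) := by
    have : Continuous (fun v => (Z₀, conj Z₀, U₀) + polarRe (S := S) v) := by fun_prop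
    simpa using this.tendsto 0
  have hH := eventually_zero_of_eventually_real polarRe polarRe_add hHd (by
    filter_upwards [hre.eventually (hmt.eventually hT)] with v hv
    set w := (Z₀, conj Z₀, U₀) + polarRe v with hw
    have h1 : conj w.1 = w.2.1 := by simp [hw, conj_polarRe_fst]
    have h2 : conj w.2.2 = w.2.2 := by simp [hw, conj_polarRe_snd, hU₀c]
    have h3 := (mem_complexTangentAt_iff _ _).1 (hv (mem_quartic_of_conj_eq h1 h2))
    simp only [H, h3]
    rw [show (m w).1 = w.1 from rfl, h1, sub_self])
  -- The third coordinate is chosen so that `m` sends the point to `(Z, W)` for every `t`: the point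
  -- of the quartic's ambient space stays fixed while `ζ` moves.
  have hn : Filter.Tendsto (fun v : (Cplx S × Cplx S) × ℂ =>
      ((v.1.1, conj Z₀ + v.2 • 1, v.1.2 - Complex.I • (v.1.1 ^ 2 * (conj Z₀ + v.2 • 1) ^ 2)) :
        Cplx S × Cplx S × Cplx S)) (𝓝 ((Z₀, W₀), 0)) (𝓝 (Z₀, conj Z₀, U₀)) := by
    have : Continuous (fun v : (Cplx S × Cplx S) × ℂ =>
      ((v.1.1, conj Z₀ + v.2 • 1, v.1.2 - Complex.I • (v.1.1 ^ 2 * (conj Z₀ + v.2 • 1) ^ 2)) :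
        Cplx S × Cplx S × Cplx S)) := by fun_prop
    simpa [hU₀] using this.tendsto ((Z₀, W₀), 0)
  have hcurry := hn.eventually hH
  rw [nhds_prod_eq] at hcurry
  have hfz : ∀ᶠ q in 𝓝 (Z₀, W₀), (X q).1 * q.1 = 0 ∧ ((X q).1 = 0 → (X q).2 = 0) := by
    filter_upwards [hcurry.curry] with q hq
    simp only [H, m, sub_add_cancel] at hq
    have hneg : Filter.Tendsto (fun t : ℂ => -t) (𝓝 0) (𝓝 0) := by
      simpa using (continuous_neg (G := ℂ)).tendsto 0
    obtain ⟨t, ⟨ht1, ht2⟩, ht⟩ := (((hq.and (hneg.eventually hq)).filter_mono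
      nhdsWithin_le_nhds).and (self_mem_nhdsWithin (a := (0 : ℂ)) (s := {0}ᶜ))).exists
    have ht3 := hq.self_of_nhds
    refine ⟨?_, fun h => by simpa [h] using ht3⟩
    -- Second difference in `t` of the quadratic `(conj Z₀ + t)²`, equal to `2 t²`.
    have e : (8 * Complex.I * t ^ 2) • ((X q).1 * q.1) = 0 := by
      have e1 : ((X q).2 - (4 * Complex.I) • ((X q).1 * q.1 * (conj Z₀ + (0 : ℂ) • 1) ^ 2)) +
        ((X q).2 - (4 * Complex.I) • ((X q).1 * q.1 * (conj Z₀ + (0 : ℂ) • 1) ^ 2)) -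
        ((X q).2 - (4 * Complex.I) • ((X q).1 * q.1 * (conj Z₀ + t • 1) ^ 2)) -
        ((X q).2 - (4 * Complex.I) • ((X q).1 * q.1 * (conj Z₀ + (-t) • 1) ^ 2)) = 0 := by
        rw [ht1, ht2, ht3]; simp
      rw [← e1]
      simp only [Algebra.smul_def, map_neg, map_mul, map_pow, map_ofNat, map_zero]
      ring
    exact (smul_eq_zero.1 e).resolve_left (by simpa using ht)
  -- `Z` may be a zero divisor, so `f` is shown to vanish at the nearby points with `Z + t` a unit,
  -- and then by continuity.
  have hf : ∀ᶠ q in 𝓝 (Z₀, W₀), (X q).1 = 0 := by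
    filter_upwards [hfz.eventually_nhds, hX.eventually_analyticAt] with q hq hqa
    have hl : Continuous (fun t : ℂ => (q.1 + t • (1 : Cplx S), q.2)) := by fun_prop
    have hlt : Filter.Tendsto (fun t : ℂ => (q.1 + t • (1 : Cplx S), q.2)) (𝓝[≠] 0) (𝓝 q) := by
      have := hl.tendsto 0
      simp only [zero_smul, add_zero] at this
      exact this.mono_left nhdsWithin_le_nhds
    have hcont := (continuous_fst.tendsto (X q)).comp (hqa.continuousAt.tendsto.comp hlt)
    refine tendsto_nhds_unique (hcont.congr' ?_) tendsto_const_nhds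
    filter_upwards [hlt.eventually hq, eventually_isUnit_add_smul q.1] with t ht hu
    exact (hu.mul_left_eq_zero).1 ht.1
  filter_upwards [hf, hfz] with q h1 h2
  exact Prod.ext h1 (h2.2 h1)

end HolNondegenerate

/-! ### Equivalence of tangency and the algebraic relations for a field in normal form. -/

section Relations

variable {S : Type*} [CommRing S]

theorem quarticForm_conj_eq (Z : Cplx S) :
    Z ^ 2 * conj Z ^ 2 = ofReal (Z ^ 2 * conj Z ^ 2).re :=
  eq_ofReal_re (quarticForm_conj_im Z)

variable [Algebra ℝ S]

theorem im_affine_quadratic (q : Cplx S) (R : Cplx S →ₗ[ℂ] Cplx S)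
    (r : Cplx S →ₗ[ℂ] Cplx S →ₗ[ℂ] Cplx S) (hr : ∀ W W', r W W' = r W' W) (U V : Cplx S) :
    (q + R (U + Complex.I • V) + r (U + Complex.I • V) (U + Complex.I • V)).im =
      q.im + (R U).im + (R V).re + (r U U).im + (2 : ℝ) • (r U V).re - (r V V).im := by
  simp only [map_add, map_smul, LinearMap.add_apply, LinearMap.smul_apply, hr V U, smul_smul,
    Complex.I_mul_I, add_im, smul_im, Complex.I_re, Complex.I_im, two_smul, smul_add,
    Complex.neg_re, Complex.neg_im, Complex.one_re, Complex.one_im]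
  simp
  abel

theorem re_linear_bilinear (L : Cplx S →ₗ[ℂ] Cplx S) (B : Cplx S →ₗ[ℂ] Cplx S →ₗ[ℂ] Cplx S)
    (Z T U V : Cplx S) :
    ((L Z + B (U + Complex.I • V) Z) * T).re =
      (L Z * T).re + (B U Z * T).re - (B V Z * T).im := by
  have : (L Z + B (U + Complex.I • V) Z) * T =
      L Z * T + B U Z * T + Complex.I • (B V Z * T) := by
    simp only [map_add, map_smul, LinearMap.add_apply, LinearMap.smul_apply, add_mul,
      smul_mul_assoc]
    abel
  rw [this]
  simp only [add_re, I_smul_re]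
  abel

variable [FiniteDimensional ℝ S]

theorem analyticAt_bilin (B : Cplx S →ₗ[ℂ] Cplx S →ₗ[ℂ] Cplx S)
    {u v : Cplx S × Cplx S → Cplx S} {p : Cplx S × Cplx S} (hu : AnalyticAt ℂ u p)
    (hv : AnalyticAt ℂ v p) : AnalyticAt ℂ (fun p => B (u p) (v p)) p := by
  let B' : Cplx S →L[ℂ] Cplx S →L[ℂ] Cplx S :=
    LinearMap.toContinuousLinearMap (LinearMap.toContinuousLinearMap.toLinearMap ∘ₗ B)
  exact (B'.analyticAt_bilinear (u p, v p)).comp₂ hu hv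

theorem mem_infAut_of_relations {X : Cplx S × Cplx S → Cplx S × Cplx S}
    {L : Cplx S →ₗ[ℂ] Cplx S} {B : Cplx S →ₗ[ℂ] Cplx S →ₗ[ℂ] Cplx S} {q : S}
    {R : Cplx S →ₗ[ℂ] Cplx S} {r : Cplx S →ₗ[ℂ] Cplx S →ₗ[ℂ] Cplx S}
    (hX : ∀ᶠ p in 𝓝 (0 : Cplx S × Cplx S),
      X p = (L p.1 + B p.2 p.1, ofReal q + R p.2 + r p.2 p.2))
    (hR : ∀ U : S, (R (ofReal U)).im = 0) (hr : ∀ W W' : Cplx S, r W W' = r W' W)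
    (hri : ∀ U : S, (r (ofReal U) (ofReal U)).im = 0)
    (h1 : ∀ Z : Cplx S, ofReal (4 * (L Z * Z * conj Z ^ 2).re) = R (Z ^ 2 * conj Z ^ 2))
    (h2 : ∀ (U : S) (Z : Cplx S), ofReal (2 * (B (ofReal U) Z * Z * conj Z ^ 2).re) =
      r (ofReal U) (Z ^ 2 * conj Z ^ 2))
    (h3 : ∀ Z : Cplx S, (B (Z ^ 2 * conj Z ^ 2) Z * Z * conj Z ^ 2).im = 0) :
    X ∈ infAut (quarticFun S) := by
  constructor
  · have hL : AnalyticAt ℂ (fun p : Cplx S × Cplx S => L p.1) 0 :=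
      (L.toContinuousLinearMap.analyticAt _).comp analyticAt_fst
    have hRa : AnalyticAt ℂ (fun p : Cplx S × Cplx S => R p.2) 0 :=
      (R.toContinuousLinearMap.analyticAt _).comp analyticAt_snd
    have := (hL.add (analyticAt_bilin B analyticAt_snd analyticAt_fst)).prod
      (((analyticAt_const (v := ofReal q)).add hRa).add
        (analyticAt_bilin r analyticAt_snd analyticAt_snd))
    refine this.congr ?_
    filter_upwards [hX] with p hp
    exact hp.symm
  · filter_upwards [hX] with p hp hpQ
    have hpW : p.2 = ofReal p.2.re + Complex.I • (p.1 ^ 2 * conj p.1 ^ 2) := by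
      have := (mem_quartic_iff p).1 hpQ
      rw [← this]
      ext <;> simp
    rw [mem_tangentAt_iff, hp]
    simp only
    rw [hpW, im_affine_quadratic _ _ _ hr, mul_assoc _ p.1, re_linear_bilinear, ← mul_assoc,
      ← mul_assoc, ← mul_assoc, h3, hR, hri, ← h1, ← h2]
    have h4 := quarticForm_conj_eq p.1
    rw [h4, hri]
    simp only [ofReal_im, ofReal_re, Algebra.smul_def, map_ofNat]
    ring

/-- Both sides of the tangency condition are polynomial in the scalings of `U` and of `V = Z² (conj
Z)²`. Smallness is absorbed by these scalings, so comparing coefficients yields relations valid for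
all `U` and `Z`. -/
theorem relations_of_eventually_tangent {L : Cplx S →ₗ[ℂ] Cplx S}
    {B : Cplx S →ₗ[ℂ] Cplx S →ₗ[ℂ] Cplx S} {q : Cplx S}
    {R : Cplx S →ₗ[ℂ] Cplx S} {r : Cplx S →ₗ[ℂ] Cplx S →ₗ[ℂ] Cplx S}
    (hr : ∀ W W' : Cplx S, r W W' = r W' W)
    (hT : ∀ᶠ p in 𝓝 (0 : Cplx S × Cplx S), p ∈ quartic S →
      (L p.1 + B p.2 p.1, q + R p.2 + r p.2 p.2) ∈ tangentAt (quarticFun S) p) :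
    q.im = 0 ∧ (∀ U : S, (R (ofReal U)).im = 0) ∧
    (∀ U : S, (r (ofReal U) (ofReal U)).im = 0) ∧
    (∀ Z : Cplx S, ofReal (4 * (L Z * Z * conj Z ^ 2).re) = R (Z ^ 2 * conj Z ^ 2)) ∧
    (∀ (U : S) (Z : Cplx S), ofReal (2 * (B (ofReal U) Z * Z * conj Z ^ 2).re) =
      r (ofReal U) (Z ^ 2 * conj Z ^ 2)) ∧
    (∀ Z : Cplx S, (B (Z ^ 2 * conj Z ^ 2) Z * Z * conj Z ^ 2).im = 0) := by
  have key : ∀ (U : S) (Z : Cplx S), (q.im = 0 ∧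
      (R (Z ^ 2 * conj Z ^ 2)).re - (4 : ℝ) • (L Z * Z * conj Z ^ 2).re = 0 ∧
      (4 : ℝ) • (B (Z ^ 2 * conj Z ^ 2) Z * Z * conj Z ^ 2).im -
        (r (Z ^ 2 * conj Z ^ 2) (Z ^ 2 * conj Z ^ 2)).im = 0) ∧ ((R (ofReal U)).im = 0 ∧
      (2 : ℝ) • (r (ofReal U) (Z ^ 2 * conj Z ^ 2)).re -
        (4 : ℝ) • (B (ofReal U) Z * Z * conj Z ^ 2).re = 0) ∧
      (r (ofReal U) (ofReal U)).im = 0 := by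
    intro U Z
    set V := Z ^ 2 * conj Z ^ 2 with hV
    -- The point of the quartic over `τ Z` with real part `u U`, where `τ = m^(1/4)` makes the form
    -- equal to `m V`.
    let φ : ℝ × ℝ → Cplx S × Cplx S := fun v =>
      (((√(√v.1) : ℝ) : ℂ) • Z, ((v.2 : ℝ) : ℂ) • ofReal U + Complex.I • ((v.1 : ℝ) : ℂ) • V)
    have hφ : Filter.Tendsto φ (𝓝 (0, 0)) (𝓝 0) := by
      have : Continuous φ := by fun_prop
      have h := this.tendsto (0, 0)
      rwa [show φ (0, 0) = 0 by simp [φ]] at h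
    have hc := hφ.eventually hT
    rw [nhds_prod_eq] at hc
    -- The coefficients of `1`, `u`, `u²`, each in turn a polynomial in `m`; the zero term gives the
    -- second the shape of a quadratic.
    have hu : ∀ᶠ m : ℝ in 𝓝[>] 0,
        q.im + m • ((R V).re - (4 : ℝ) • (L Z * Z * conj Z ^ 2).re) +
          m ^ 2 • ((4 : ℝ) • (B V Z * Z * conj Z ^ 2).im - (r V V).im) = 0 ∧
        (R (ofReal U)).im + m • ((2 : ℝ) • (r (ofReal U) V).re -
          (4 : ℝ) • (B (ofReal U) Z * Z * conj Z ^ 2).re) + m ^ 2 • (0 : S) = 0 ∧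
        (r (ofReal U) (ofReal U)).im = 0 := by
      filter_upwards [hc.curry.filter_mono nhdsWithin_le_nhds, self_mem_nhdsWithin] with m hm hm0
      have hm0 : (0 : ℝ) < m := hm0
      apply quadratic_coeff_eq_zero
      filter_upwards [hm.filter_mono nhdsWithin_le_nhds] with u hu
      set τ : ℝ := √(√m) with hτ
      have hτ4 : (τ : ℂ) ^ 4 = (m : ℂ) := by
        have : τ ^ 4 = m := by
          rw [show (4 : ℕ) = 2 * 2 from rfl, pow_mul, hτ, Real.sq_sqrt (Real.sqrt_nonneg m),
            Real.sq_sqrt hm0.le]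
        exact_mod_cast this
      have hcz : conj ((τ : ℂ) • Z) = (τ : ℂ) • conj Z := by
        rw [conj_smul, Complex.conj_ofReal]
      have hV4 : ((τ : ℂ) • Z) ^ 2 * conj ((τ : ℂ) • Z) ^ 2 = (m : ℂ) • V := by
        rw [hcz, hV, ← hτ4]
        simp only [Algebra.smul_def, map_pow]
        ring
      have hQ : φ (m, u) ∈ quartic S := by
        rw [mem_quartic_iff]
        simp only [φ]
        have hVi : V.im = 0 := quarticForm_conj_im Z
        rw [hV4]
        ext <;> simp [hVi, real_smul_re, real_smul_im]
      have ht := hu hQ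
      rw [mem_tangentAt_iff] at ht
      simp only [φ] at ht
      rw [im_affine_quadratic _ _ _ hr, mul_assoc _ ((τ : ℂ) • Z), re_linear_bilinear] at ht
      have e : ∀ Y : Cplx S, ((τ : ℂ) • Y) * (((τ : ℂ) • Z) * conj ((τ : ℂ) • Z) ^ 2) =
          (m : ℂ) • (Y * Z * conj Z ^ 2) := by
        intro Y
        rw [hcz, ← hτ4]
        simp only [Algebra.smul_def, map_pow]
        ring
      simp only [map_smul, LinearMap.smul_apply, ← hτ] at ht
      simp only [e] at ht
      simp only [smul_re, smul_im, Complex.ofReal_re, Complex.ofReal_im, zero_smul, sub_zero,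
        add_zero, smul_mul_assoc] at ht
      rw [← sub_eq_zero] at ht
      refine Eq.trans ?_ ht
      module
    have h1 := quadratic_coeff_eq_zero (hu.mono fun m hm => hm.1)
    have h2 := quadratic_coeff_eq_zero (hu.mono fun m hm => hm.2.1)
    obtain ⟨m, hm⟩ := hu.exists
    exact ⟨h1, ⟨h2.1, h2.2.1⟩, hm.2.2⟩
  have hRi : ∀ U : S, (R (ofReal U)).im = 0 := fun U => (key U 0).2.1.1
  have hri : ∀ U : S, (r (ofReal U) (ofReal U)).im = 0 := fun U => (key U 0).2.2
  -- Polarization of the symmetric form `r`.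
  have hri2 : ∀ U V : S, (r (ofReal U) (ofReal V)).im = 0 := by
    intro U V
    have e : ofReal (U + V) = ofReal U + ofReal V := by ext <;> simp
    have h := hri (U + V)
    rw [e] at h
    simp only [map_add, LinearMap.add_apply, add_im, hri, hr (ofReal V) (ofReal U), add_zero,
      zero_add] at h
    rw [← two_smul ℝ] at h
    exact (smul_eq_zero.1 h).resolve_left two_ne_zero
  refine ⟨(key 0 0).1.1, hRi, hri, fun Z => ?_, fun U Z => ?_, fun Z => ?_⟩
  · have h := (key 0 Z).1.2.1
    rw [sub_eq_zero] at h
    have h2 := hRi (Z ^ 2 * conj Z ^ 2).re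
    rw [← quarticForm_conj_eq] at h2
    rw [eq_ofReal_re h2, h, Algebra.smul_def, map_ofNat]
  · have h := (key U Z).2.1.2
    have h2 := hri2 U (Z ^ 2 * conj Z ^ 2).re
    rw [← quarticForm_conj_eq] at h2
    have h3 : (2 : ℝ) • ((r (ofReal U) (Z ^ 2 * conj Z ^ 2)).re -
        (2 : ℝ) • (B (ofReal U) Z * Z * conj Z ^ 2).re) = 0 := by
      rw [← h]
      module
    have h4 := sub_eq_zero.1 ((smul_eq_zero.1 h3).resolve_left two_ne_zero)
    rw [eq_ofReal_re h2, h4, Algebra.smul_def, map_ofNat]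
  · have h := (key 0 Z).1.2.2
    have h2 := hri (Z ^ 2 * conj Z ^ 2).re
    rw [← quarticForm_conj_eq] at h2
    rw [h2, sub_zero] at h
    exact (smul_eq_zero.1 h).resolve_left (by norm_num)

end Relations

/-! ### Consequences of the complexified tangency condition. -/

section Polarized

variable {S : Type*} [CommRing S] [Algebra ℝ S] [FiniteDimensional ℝ S]

/-- The complexified tangency condition, in the variables `(Z, ζ, P)`. -/
def Polarized (κ : ℂ) (f g f' g' : Cplx S × Cplx S → Cplx S) : Prop :=
  ∀ᶠ v : Cplx S × Cplx S × Cplx S in 𝓝 0,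
    g (v.1, v.2.2) - g' (v.2.1, v.2.2 - (2 * κ) • (v.1 ^ 2 * v.2.1 ^ 2)) =
      (4 * κ) • (f (v.1, v.2.2) * v.1 * v.2.1 ^ 2 +
        f' (v.2.1, v.2.2 - (2 * κ) • (v.1 ^ 2 * v.2.1 ^ 2)) * v.2.1 * v.1 ^ 2)

/-- Exchanging `Z` and `ζ` and taking the shifted argument as the new `P` reverses the sign of the
shift. Every statement on `f`, `g` thus has a counterpart for `f'`, `g'`. -/
theorem Polarized.symm {κ : ℂ} {f g f' g' : Cplx S × Cplx S → Cplx S}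
    (h : Polarized κ f g f' g') : Polarized (-κ) f' g' f g := by
  have ht : Filter.Tendsto (fun v : Cplx S × Cplx S × Cplx S =>
      ((v.2.1, v.1, v.2.2 + (2 * κ) • (v.1 ^ 2 * v.2.1 ^ 2)) : Cplx S × Cplx S × Cplx S))
      (𝓝 0) (𝓝 0) := by
    have : Continuous (fun v : Cplx S × Cplx S × Cplx S =>
      ((v.2.1, v.1, v.2.2 + (2 * κ) • (v.1 ^ 2 * v.2.1 ^ 2)) : Cplx S × Cplx S × Cplx S)) := by
      fun_prop
    exact tendsto_zero_of_eq_zero this (by simp)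
  filter_upwards [ht.eventually h] with v hv
  simp only [mul_comm (v.2.1 ^ 2) (v.1 ^ 2), add_sub_cancel_right] at hv
  simp only [mul_neg, neg_smul, sub_neg_eq_add]
  rw [← neg_sub, hv, add_comm (_ * _ * _)]

/-- A holomorphic field tangent to the quartic satisfies the complexified tangency condition. -/
theorem polarized_of_mem_infAut {X : Cplx S × Cplx S → Cplx S × Cplx S}
    (hX : X ∈ infAut (quarticFun S)) :
    Polarized Complex.I (fun p => (X p).1) (fun p => (X p).2)
      (fun p => conj (X (conj p.1, conj p.2)).1) (fun p => conj (X (conj p.1, conj p.2)).2) := by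
  obtain ⟨hXa, hT⟩ := hX
  let c : Cplx S × Cplx S →L[ℝ] Cplx S × Cplx S := conjCLM.prodMap conjCLM
  have hc : ∀ (t : ℂ) v, c (t • v) = conj t • c v := fun t v =>
    Prod.ext (conj_smul t v.1) (conj_smul t v.2)
  have hd1 : ∀ᶠ p in 𝓝 0, DifferentiableAt ℂ X p :=
    hXa.eventually_analyticAt.mono fun p hp => hp.differentiableAt
  have hct : Filter.Tendsto c (𝓝 0) (𝓝 0) := by
    simpa using c.continuous.tendsto 0
  have hd2 : ∀ᶠ p in 𝓝 0, DifferentiableAt ℂ (fun p => conj (X (c p)).1) p :=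
    (hct.eventually hd1).mono fun p hp => differentiableAt_conj_comp c hc hp.fst
  have hd3 : ∀ᶠ p in 𝓝 0, DifferentiableAt ℂ (fun p => conj (X (c p)).2) p :=
    (hct.eventually hd1).mono fun p hp => differentiableAt_conj_comp c hc hp.snd
  let m : Cplx S × Cplx S × Cplx S → Cplx S × Cplx S :=
    fun v => (v.1, v.2.2 + Complex.I • (v.1 ^ 2 * v.2.1 ^ 2))
  let n : Cplx S × Cplx S × Cplx S → Cplx S × Cplx S :=
    fun v => (v.2.1, v.2.2 - Complex.I • (v.1 ^ 2 * v.2.1 ^ 2))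
  have hm : Differentiable ℂ m := by fun_prop
  have hn : Differentiable ℂ n := by fun_prop
  have hmt : Filter.Tendsto m (𝓝 0) (𝓝 0) := by
    exact tendsto_zero_of_eq_zero hm.continuous (by simp [m])
  have hnt : Filter.Tendsto n (𝓝 0) (𝓝 0) := by
    exact tendsto_zero_of_eq_zero hn.continuous (by simp [n])
  -- `m` and `n` polarize `W` and `conj W`. On real points `c (n w) = m w`, and the equation `H = 0`
  -- is the tangency condition.
  let H : Cplx S × Cplx S × Cplx S → Cplx S := fun v =>
    (X (m v)).2 - conj (X (c (n v))).2 - (4 * Complex.I) • ((X (m v)).1 * v.1 * v.2.1 ^ 2 +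
      conj (X (c (n v))).1 * v.2.1 * v.1 ^ 2)
  have hHd : ∀ᶠ v in 𝓝 0, DifferentiableAt ℂ H v := by
    filter_upwards [hmt.eventually hd1, hnt.eventually hd2, hnt.eventually hd3] with v h1 h2 h3
    have h1' : DifferentiableAt ℂ (fun v => X (m v)) v := h1.comp v (hm v)
    have h2' : DifferentiableAt ℂ (fun v => conj (X (c (n v))).1) v := h2.comp v (hn v)
    have h3' : DifferentiableAt ℂ (fun v => conj (X (c (n v))).2) v := h3.comp v (hn v)
    fun_prop
  have hre : Filter.Tendsto (polarRe (S := S)) (𝓝 0) (𝓝 0) := by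
    simpa using (polarRe (S := S)).continuous.tendsto 0
  have hH := eventually_zero_of_eventually_real polarRe polarRe_add hHd (by
    filter_upwards [hre.eventually (hmt.eventually hT)] with v hv
    rw [zero_add]
    set w := polarRe v with hw
    have h1 : conj w.1 = w.2.1 := conj_polarRe_fst v
    have h2 : conj w.2.2 = w.2.2 := conj_polarRe_snd v
    have h1' : conj w.2.1 = w.1 := by rw [← h1, Cplx.conj_conj]
    have h3 := (mem_tangentAt_iff _ _).1 (hv (mem_quartic_of_conj_eq h1 h2))
    have h4 : c (n w) = m w := by
      refine Prod.ext h1' ?_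
      change conj (w.2.2 - Complex.I • (w.1 ^ 2 * w.2.1 ^ 2)) =
        w.2.2 + Complex.I • (w.1 ^ 2 * w.2.1 ^ 2)
      rw [map_sub, conj_smul, map_mul, map_pow, map_pow, h1, h1', h2, Complex.conj_I, neg_smul,
        sub_neg_eq_add, mul_comm]
    simp only [H, h4]
    have h5 : conj (X (m w)).1 * w.2.1 * w.1 ^ 2 = conj ((X (m w)).1 * w.1 * w.2.1 ^ 2) := by
      rw [map_mul, map_mul, map_pow, h1, h1']
    rw [h5, sub_conj, add_conj, h3, sub_eq_zero]
    change (2 * Complex.I) • ofReal ((4 : ℝ) • ((X (m w)).1 * w.1 * conj w.1 ^ 2).re) = _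
    rw [h1]
    ext <;> simp [smul_smul]
    norm_num)
  -- Passage from the variable `Re W` to `P = W`, which moves the whole shift `2i Z² ζ²` into the
  -- conjugate argument.
  have hback : Filter.Tendsto (fun v : Cplx S × Cplx S × Cplx S =>
      ((v.1, v.2.1, v.2.2 - Complex.I • (v.1 ^ 2 * v.2.1 ^ 2)) : Cplx S × Cplx S × Cplx S))
      (𝓝 0) (𝓝 0) := by
    have : Continuous (fun v : Cplx S × Cplx S × Cplx S =>
      ((v.1, v.2.1, v.2.2 - Complex.I • (v.1 ^ 2 * v.2.1 ^ 2)) : Cplx S × Cplx S × Cplx S)) := by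
      fun_prop
    exact tendsto_zero_of_eq_zero this (by simp)
  filter_upwards [hback.eventually hH] with v hv
  simp only [H, m, n, sub_add_cancel, sub_sub, ← two_smul ℂ (Complex.I • _), smul_smul] at hv
  rw [← sub_sub, sub_eq_zero] at hv
  exact hv

theorem eventually_curry {A B : Type*} [TopologicalSpace A] [TopologicalSpace B] {a : A} {b : B}
    {P : A × B → Prop} (h : ∀ᶠ v in 𝓝 (a, b), P v) :
    ∀ᶠ x in 𝓝 a, ∀ᶠ y in 𝓝 b, P (x, y) := by
  rw [nhds_prod_eq] at h
  exact h.curry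

theorem tendsto_neg_nhds_zero : Filter.Tendsto (fun t : ℂ => -t) (𝓝 0) (𝓝 0) := by
  simpa using (continuous_neg (G := ℂ)).tendsto 0

/-- The second component does not depend on `Z`. -/
theorem Polarized.eventually_eq {κ : ℂ} {f g f' g' : Cplx S × Cplx S → Cplx S}
    (h : Polarized κ f g f' g') : ∀ᶠ p in 𝓝 (0 : Cplx S × Cplx S), g p = g' (0, p.2) := by
  have ht : Filter.Tendsto (fun p : Cplx S × Cplx S =>
      ((p.1, 0, p.2) : Cplx S × Cplx S × Cplx S)) (𝓝 0) (𝓝 0) := by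
    have : Continuous (fun p : Cplx S × Cplx S =>
      ((p.1, 0, p.2) : Cplx S × Cplx S × Cplx S)) := by fun_prop
    exact this.tendsto 0
  filter_upwards [ht.eventually h] with p hp
  simpa [sub_eq_zero] using hp

/-- Putting `ζ = 0`, and `Z = 0` in the symmetric identity, shows that both second components agree
with one function of `P`. -/
theorem Polarized.reduce {κ : ℂ} {f g f' g' : Cplx S × Cplx S → Cplx S}
    (h : Polarized κ f g f' g') :
    Polarized κ f (fun p => g (0, p.2)) f' (fun p => g (0, p.2)) := by
  have h1 := h.eventually_eq
  have h2 := h.symm.eventually_eq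
  have t1 : Filter.Tendsto (fun v : Cplx S × Cplx S × Cplx S => (v.1, v.2.2)) (𝓝 0) (𝓝 0) := by
    have : Continuous (fun v : Cplx S × Cplx S × Cplx S => (v.1, v.2.2)) := by fun_prop
    exact this.tendsto 0
  have t2 : Filter.Tendsto (fun v : Cplx S × Cplx S × Cplx S => ((0 : Cplx S), v.2.2))
      (𝓝 0) (𝓝 0) := by
    have : Continuous (fun v : Cplx S × Cplx S × Cplx S => ((0 : Cplx S), v.2.2)) := by fun_prop
    exact this.tendsto 0
  have t3 : Filter.Tendsto (fun v : Cplx S × Cplx S × Cplx S =>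
      (v.2.1, v.2.2 - (2 * κ) • (v.1 ^ 2 * v.2.1 ^ 2))) (𝓝 0) (𝓝 0) := by
    have : Continuous (fun v : Cplx S × Cplx S × Cplx S =>
      (v.2.1, v.2.2 - (2 * κ) • (v.1 ^ 2 * v.2.1 ^ 2))) := by fun_prop
    exact tendsto_zero_of_eq_zero this (by simp)
  filter_upwards [h, t1.eventually h1, t2.eventually h1, t3.eventually h2] with v h0 e1 e2 e3
  rw [e1, e3] at h0
  simp only [e2, h0]

/-- With `Z = τ`, `ζ = s`, every term except `f' ζ Z²` depends on `s` only through `s²`. So `f'`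
along this curve is odd in `s`, and its value at `s = 0` vanishes by continuity. -/
theorem Polarized.eventually_zero {κ : ℂ} (hκ : κ ≠ 0) {f g f' g' : Cplx S × Cplx S → Cplx S}
    (h : Polarized κ f g f' g') (hg : ∀ p, g' p = g (0, p.2))
    (hf' : ∀ᶠ p in 𝓝 0, ContinuousAt f' p) :
    ∀ᶠ P in 𝓝 (0 : Cplx S), f' (0, P) = 0 := by
  have ht : Filter.Tendsto (fun v : (Cplx S × ℂ) × ℂ =>
      ((v.1.2 • 1, v.2 • 1, v.1.1) : Cplx S × Cplx S × Cplx S)) (𝓝 ((0, 0), 0)) (𝓝 0) := by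
    have : Continuous (fun v : (Cplx S × ℂ) × ℂ =>
      ((v.1.2 • 1, v.2 • 1, v.1.1) : Cplx S × Cplx S × Cplx S)) := by fun_prop
    exact tendsto_zero_of_eq_zero this (by simp)
  have ht2 : Filter.Tendsto (fun P : Cplx S => ((0 : Cplx S), P)) (𝓝 0) (𝓝 0) := by
    have : Continuous (fun P : Cplx S => ((0 : Cplx S), P)) := by fun_prop
    exact this.tendsto 0
  filter_upwards [eventually_curry (eventually_curry (ht.eventually h)), ht2.eventually hf']
    with P hP hcont
  obtain ⟨τ, hτ, hτ0⟩ := ((hP.filter_mono nhdsWithin_le_nhds).and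
    (self_mem_nhdsWithin (a := (0 : ℂ)) (s := {0}ᶜ))).exists
  have hτ0 : τ ≠ 0 := hτ0
  let N : ℂ → Cplx S := fun s =>
    f' (s • 1, P - (2 * κ) • ((τ • (1 : Cplx S)) ^ 2 * (s • 1) ^ 2))
  have hN : ContinuousAt N 0 := by
    have hl : Continuous fun s : ℂ => ((s • 1,
      P - (2 * κ) • ((τ • (1 : Cplx S)) ^ 2 * (s • 1) ^ 2)) : Cplx S × Cplx S) := by fun_prop
    refine ContinuousAt.comp (g := f') ?_ hl.continuousAt
    simpa using hcont
  have hsum : ∀ᶠ s in 𝓝[≠] 0, N s + N (-s) = 0 := by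
    filter_upwards [hτ.filter_mono nhdsWithin_le_nhds,
      (tendsto_neg_nhds_zero.eventually hτ).filter_mono nhdsWithin_le_nhds,
      self_mem_nhdsWithin] with s h1 h2 hs
    have hs : s ≠ 0 := hs
    have e : (4 * κ * s * τ ^ 2) • (N s + N (-s)) = 0 := by
      have hsq : ((-s) • (1 : Cplx S)) ^ 2 = (s • 1) ^ 2 := by
        rw [neg_smul, neg_sq]
      have e0 : N (-s) = f' ((-s) • 1, P - (2 * κ) • ((τ • (1 : Cplx S)) ^ 2 * (s • 1) ^ 2)) := by
        simp only [N, hsq]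
      simp only [hg, hsq] at h1 h2
      rw [h1] at h2
      rw [e0]
      simp only [N]
      rw [← sub_eq_zero] at h2
      rw [← h2]
      simp only [Algebra.smul_def, map_mul, map_pow, map_neg]
      ring
    exact (smul_eq_zero.1 e).resolve_left (by simp [hκ, hs, hτ0])
  have hneg : ContinuousAt (fun s => N (-s)) 0 := by
    refine ContinuousAt.comp (g := N) (by simpa using hN) continuous_neg.continuousAt
  have hlim : Filter.Tendsto (fun s => N s + N (-s)) (𝓝[≠] 0) (𝓝 (N 0 + N (-0))) :=
    (hN.add hneg).tendsto.mono_left nhdsWithin_le_nhds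
  have h0 := tendsto_nhds_unique (hlim.congr' hsum) tendsto_const_nhds
  rw [neg_zero, ← two_smul ℂ] at h0
  have := (smul_eq_zero.1 h0).resolve_left two_ne_zero
  simpa [N] using this

/-- The product `f (Z, P) * Z` is a linear function of `Z ^ 2`. -/
theorem Polarized.eventually_mul_eq {κ : ℂ} (hκ : κ ≠ 0)
    {f g f' g' : Cplx S × Cplx S → Cplx S}
    (h : Polarized κ f g f' g') (hg : ∀ p, g' p = g (0, p.2)) (hg2 : ∀ p, g p = g (0, p.2))
    (hf' : ∀ᶠ p in 𝓝 0, DifferentiableAt ℂ f' p) (hgd : ∀ᶠ p in 𝓝 0, DifferentiableAt ℂ g p) :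
    ∃ M : Cplx S → Cplx S →L[ℂ] Cplx S,
      ∀ᶠ p in 𝓝 (0 : Cplx S × Cplx S), f p * p.1 = M p.2 (p.1 ^ 2) := by
  -- The limit of the identity at `ζ = s • 1` divided by `4 κ s²`: half the derivative of `g` in
  -- `P`, minus multiplication by the derivative of `f'` in the direction `1`.
  refine ⟨fun P => (2⁻¹ : ℂ) • (fderiv ℂ g (0, P)).comp (ContinuousLinearMap.inr ℂ _ _) -
    ContinuousLinearMap.mul ℂ (Cplx S) (fderiv ℂ f' (0, P) (1, 0)), ?_⟩
  have ht : Filter.Tendsto (fun v : (Cplx S × Cplx S) × ℂ =>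
      ((v.1.1, v.2 • 1, v.1.2) : Cplx S × Cplx S × Cplx S)) (𝓝 ((0, 0), 0)) (𝓝 0) := by
    have : Continuous (fun v : (Cplx S × Cplx S) × ℂ =>
      ((v.1.1, v.2 • 1, v.1.2) : Cplx S × Cplx S × Cplx S)) := by fun_prop
    exact tendsto_zero_of_eq_zero this (by simp)
  have t2 : Filter.Tendsto (fun p : Cplx S × Cplx S => p.2) (𝓝 0) (𝓝 0) :=
    continuous_snd.tendsto _
  have t3 : Filter.Tendsto (fun p : Cplx S × Cplx S => ((0 : Cplx S), p.2)) (𝓝 0) (𝓝 0) := by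
    have : Continuous (fun p : Cplx S × Cplx S => ((0 : Cplx S), p.2)) := by fun_prop
    exact this.tendsto 0
  filter_upwards [eventually_curry (ht.eventually h), t3.eventually hf', t3.eventually hgd,
    t2.eventually (h.eventually_zero hκ hg (hf'.mono fun p hp => hp.continuousAt))]
    with p hp hfd hgd hf0
  obtain ⟨Z, P⟩ := p
  simp only [hg] at hp
  rw [hg2] at hp
  simp only at hp hfd hgd hf0
  let N : ℂ → Cplx S := fun s => f' (s • 1, P - (2 * κ) • (Z ^ 2 * (s • (1 : Cplx S)) ^ 2))
  have hN : HasDerivAt N (fderiv ℂ f' (0, P) (1, 0)) 0 := by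
    have h1 : HasDerivAt (fun s : ℂ => s • (1 : Cplx S)) ((1 : ℂ) • (1 : Cplx S)) 0 :=
      (hasDerivAt_id (0 : ℂ)).smul_const _
    -- The shift of `P` is quadratic in `s`, so only the derivative of `f'` in its first variable
    -- survives.
    have h2 : HasDerivAt (fun s : ℂ => P - (2 * κ) • (Z ^ 2 * (s • (1 : Cplx S)) ^ 2)) 0 0 := by
      have := (((h1.pow 2).const_mul (Z ^ 2)).const_smul (2 * κ)).const_sub P
      simpa using this
    have h3 := h1.prodMk h2
    rw [one_smul] at h3
    refine HasFDerivAt.comp_hasDerivAt (l := f') 0 ?_ h3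
    simpa using hfd.hasFDerivAt
  have hN0 : N 0 = 0 := by simpa [N] using hf0
  have hNs := hasDerivAt_iff_tendsto_slope_zero.1 hN
  simp only [zero_add, hN0, sub_zero] at hNs
  let K : ℂ → Cplx S := fun u => g (0, P - (2 * κ * u) • Z ^ 2)
  have hK : HasDerivAt K (-((2 * κ) • fderiv ℂ g (0, P) (0, Z ^ 2))) 0 := by
    have h2 : HasDerivAt (fun u : ℂ => P - (2 * κ * u) • Z ^ 2) (-((2 * κ) • Z ^ 2)) 0 := by
      have := (((hasDerivAt_id (0 : ℂ)).const_mul (2 * κ)).smul_const (Z ^ 2)).const_sub P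
      simpa using this
    have h3 := (hasDerivAt_const (0 : ℂ) (0 : Cplx S)).prodMk h2
    have e : fderiv ℂ g (0, P) (0, -((2 * κ) • Z ^ 2)) =
        -((2 * κ) • fderiv ℂ g (0, P) (0, Z ^ 2)) := by
      rw [← map_smul, ← map_neg]
      simp
    rw [← e]
    refine HasFDerivAt.comp_hasDerivAt (l := g) 0 ?_ h3
    simpa using hgd.hasFDerivAt
  have hKs := hasDerivAt_iff_tendsto_slope_zero.1 hK
  have hsq : Filter.Tendsto (fun s : ℂ => s ^ 2) (𝓝[≠] 0) (𝓝[≠] 0) := by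
    refine tendsto_nhdsWithin_iff.2 ⟨?_, ?_⟩
    · have : Continuous (fun s : ℂ => s ^ 2) := by fun_prop
      simpa using (this.tendsto 0).mono_left (nhdsWithin_le_nhds (s := {0}ᶜ))
    · filter_upwards [self_mem_nhdsWithin] with s hs
      simpa using hs
  have hKs2 := hKs.comp hsq
  have hcomb := (hKs2.const_smul ((4 * κ)⁻¹)).neg.sub (hNs.mul_const (Z ^ 2))
  have heq : ∀ᶠ s in 𝓝[≠] (0 : ℂ), f (Z, P) * Z = -((4 * κ)⁻¹ • ((fun t => t⁻¹ •
      (K (0 + t) - K 0)) ∘ fun s => s ^ 2) s) - s⁻¹ • N s * Z ^ 2 := by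
    filter_upwards [hp.filter_mono nhdsWithin_le_nhds, self_mem_nhdsWithin] with s hs hs0
    have hs0 : s ≠ 0 := hs0
    have hK0 : K 0 = g (0, P) := by simp [K]
    have hKs : K (0 + s ^ 2) = g (0, P - (2 * κ) • (Z ^ 2 * (s • (1 : Cplx S)) ^ 2)) := by
      simp only [K, smul_pow, one_pow, mul_smul_comm, mul_one, smul_smul, zero_add]
    have e : K (0 + s ^ 2) - K 0 =
        -((4 * κ) • (s ^ 2 • (f (Z, P) * Z) + s • (N s * Z ^ 2))) := by
      rw [hK0, hKs, ← neg_sub, hs]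
      simp only [N, smul_pow, one_pow, mul_smul_comm, mul_one, smul_mul_assoc]
    simp only [Function.comp, e]
    simp only [smul_neg, neg_neg, smul_mul_assoc]
    have hsk : (4 * κ) ≠ 0 := by simpa using hκ
    rw [smul_comm (s ^ 2)⁻¹, inv_smul_smul₀ hsk, smul_add, inv_smul_smul₀ (pow_ne_zero 2 hs0),
      smul_smul, show (s ^ 2)⁻¹ * s = s⁻¹ by field_simp]
    abel
  have hfin := tendsto_nhds_unique (hcomb.congr' (heq.mono fun s hs => hs.symm))
    tendsto_const_nhds
  rw [← hfin]
  have hc : (4 * κ)⁻¹ * (2 * κ) = 2⁻¹ := by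
    field_simp
    norm_num
  rw [smul_neg, neg_neg, smul_smul, hc]
  simp

/-- The first component is homogeneous of degree one in `Z`. -/
theorem eventually_smul_eq {f : Cplx S × Cplx S → Cplx S} {M : Cplx S → Cplx S →L[ℂ] Cplx S}
    (hM : ∀ᶠ p in 𝓝 (0 : Cplx S × Cplx S), f p * p.1 = M p.2 (p.1 ^ 2))
    (hfd : ∀ᶠ p in 𝓝 0, DifferentiableAt ℂ f p) (hf0 : ∀ᶠ P in 𝓝 (0 : Cplx S), f (0, P) = 0)
    {Z : Cplx S} (hZ : IsUnit Z) : ∀ᶠ v in 𝓝 (0 : ℂ × Cplx S),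
      f (v.1 • Z, v.2) = v.1 • fderiv ℂ f (0, v.2) (Z, 0) := by
  have ht : Filter.Tendsto (fun v : ℂ × Cplx S => (v.1 • Z, v.2)) (𝓝 0) (𝓝 0) := by
    have : Continuous (fun v : ℂ × Cplx S => (v.1 • Z, v.2)) := by fun_prop
    exact tendsto_zero_of_eq_zero this (by simp)
  have t2 : Filter.Tendsto (fun v : ℂ × Cplx S => ((0 : Cplx S), v.2)) (𝓝 0) (𝓝 0) := by
    have : Continuous (fun v : ℂ × Cplx S => ((0 : Cplx S), v.2)) := by fun_prop
    exact this.tendsto 0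
  have t3 : Filter.Tendsto (fun v : ℂ × Cplx S => v.2) (𝓝 0) (𝓝 0) := continuous_snd.tendsto _
  obtain ⟨δ, hδ, hb⟩ := Metric.eventually_nhds_iff_ball.1
    ((ht.eventually hM).and ((t2.eventually hfd).and (t3.eventually hf0)))
  filter_upwards [Metric.ball_mem_nhds 0 hδ] with v hv
  obtain ⟨τ, P⟩ := v
  have hmem : ∀ t : ℂ, ((t, P) : ℂ × Cplx S) ∈ Metric.ball 0 δ ↔ ‖t‖ < δ ∧ ‖P‖ < δ := by
    intro t
    rw [mem_ball_zero_iff, Prod.norm_def, max_lt_iff]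
  obtain ⟨hτ, hP⟩ := (hmem τ).1 hv
  obtain ⟨-, hd, h0⟩ := hb _ ((hmem 0).2 ⟨by simpa using hδ, hP⟩)
  simp only at hd h0
  -- Both `f (t Z) t Z` and `f (s Z) s Z` are multiples of `M (Z²)`, by `t²` and `s²`; the unit `Z`
  -- is then cancelled.
  have hhom : ∀ s t : ℂ, ‖s‖ < δ → ‖t‖ < δ → s • f (t • Z, P) = t • f (s • Z, P) := by
    intro s t hs ht
    by_cases hs0 : s = 0
    · simp [hs0, h0]
    by_cases ht0 : t = 0
    · simp [ht0, h0]
    have e1 := (hb _ ((hmem s).2 ⟨hs, hP⟩)).1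
    have e2 := (hb _ ((hmem t).2 ⟨ht, hP⟩)).1
    simp only [smul_pow, map_smul] at e1 e2
    have e : ((s * t) • (s • f (t • Z, P) - t • f (s • Z, P))) * Z = 0 := by
      have : ((s * t) • (s • f (t • Z, P) - t • f (s • Z, P))) * Z =
        s ^ 2 • (f (t • Z, P) * t • Z) - t ^ 2 • (f (s • Z, P) * s • Z) := by
        simp only [Algebra.smul_def, map_mul, map_pow]
        ring
      rw [this, e1, e2, smul_comm, sub_self]
    have e3 := (smul_eq_zero.1 (hZ.mul_left_eq_zero.1 e)).resolve_left (by simp [hs0, ht0])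
    exact sub_eq_zero.1 e3
  obtain ⟨ε, hε0, hε⟩ : ∃ ε : ℂ, ε ≠ 0 ∧ ‖ε‖ < δ := by
    refine ⟨((δ / 2 : ℝ) : ℂ), by simpa using hδ.ne', ?_⟩
    rw [Complex.norm_real, Real.norm_of_nonneg (by positivity)]
    linarith
  have hlin : ∀ t : ℂ, ‖t‖ < δ → f (t • Z, P) = t • ε⁻¹ • f (ε • Z, P) := by
    intro t ht
    rw [smul_comm, ← hhom ε t hε ht, inv_smul_smul₀ hε0]
  have hder : HasDerivAt (fun t : ℂ => f (t • Z, P)) (fderiv ℂ f (0, P) (Z, 0)) 0 := by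
    have h1 : HasDerivAt (fun s : ℂ => s • Z) ((1 : ℂ) • Z) 0 :=
      (hasDerivAt_id (0 : ℂ)).smul_const _
    have h3 := h1.prodMk (hasDerivAt_const (0 : ℂ) P)
    rw [one_smul] at h3
    refine HasFDerivAt.comp_hasDerivAt (l := f) 0 ?_ h3
    simpa using hd.hasFDerivAt
  have hder2 : HasDerivAt (fun t : ℂ => f (t • Z, P)) ((1 : ℂ) • ε⁻¹ • f (ε • Z, P)) 0 := by
    refine ((hasDerivAt_id (0 : ℂ)).smul_const _).congr_of_eventuallyEq ?_
    filter_upwards [Metric.ball_mem_nhds 0 hδ] with t ht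
    exact hlin t (by simpa using ht)
  rw [hder.unique hder2, one_smul]
  exact hlin τ hτ

end Polarized

/-! ### The normal form of the field. -/

section Jets

variable {S : Type*} [CommRing S] [Algebra ℝ S] [FiniteDimensional ℝ S]

/-- Along the lines through `Z ^ 2 * ζ ^ 2`, the first component is affine and the second component
quadratic. -/
theorem Polarized.exists_affine {κ : ℂ} (hκ : κ ≠ 0) {f g f' g' : Cplx S × Cplx S → Cplx S}
    (h : Polarized κ f g f' g') (hg : ∀ p, g' p = g (0, p.2)) (hg2 : ∀ p, g p = g (0, p.2))
    {Φ Φ' : Cplx S → Cplx S} {Z ζ : Cplx S} (hZ : IsUnit Z) (hζ : IsUnit ζ)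
    (hf : ∀ᶠ v in 𝓝 (0 : ℂ × Cplx S), f (v.1 • Z, v.2) = v.1 • Φ v.2)
    (hf' : ∀ᶠ v in 𝓝 (0 : ℂ × Cplx S), f' (v.1 • ζ, v.2) = v.1 • Φ' v.2) :
    ∃ c c₁ c₂ : Cplx S, ∀ᶠ x in 𝓝 (0 : ℂ),
      Φ (x • (Z ^ 2 * ζ ^ 2)) = Φ 0 + x • c ∧
      g (0, x • (Z ^ 2 * ζ ^ 2)) = g (0, 0) + x • c₁ + x ^ 2 • c₂ := by
  set V := Z ^ 2 * ζ ^ 2 with hV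
  have t1 : Filter.Tendsto (fun v : ℂ × ℂ × ℂ =>
      ((v.1 • Z, v.1 • ζ, v.2.1 • V) : Cplx S × Cplx S × Cplx S)) (𝓝 0) (𝓝 0) := by
    refine tendsto_zero_of_eq_zero (by fun_prop) (by simp)
  have t2 : Filter.Tendsto (fun v : ℂ × ℂ × ℂ => (v.1, v.2.1 • V)) (𝓝 0) (𝓝 0) := by
    refine tendsto_zero_of_eq_zero (by fun_prop) (by simp)
  have t3 : Filter.Tendsto (fun v : ℂ × ℂ × ℂ => (v.1, v.2.2 • V)) (𝓝 0) (𝓝 0) := by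
    refine tendsto_zero_of_eq_zero (by fun_prop) (by simp)
  obtain ⟨δ, hδ, hb⟩ := Metric.eventually_nhds_iff_ball.1
    ((t1.eventually h).and ((t2.eventually hf).and (t3.eventually hf')))
  -- The bound `‖κ‖ δ⁴` keeps the fourth root `u` of `(x - y) / (2 κ)` inside the `δ`-ball, as `‖x -
  -- y‖ < 2 ε`.
  obtain ⟨ε, hε, hεδ, hε4⟩ : ∃ ε : ℝ, 0 < ε ∧ ε ≤ δ ∧ ε ≤ ‖κ‖ * δ ^ 4 := by
    have : 0 < ‖κ‖ := norm_pos_iff.2 hκ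
    exact ⟨min δ (‖κ‖ * δ ^ 4), by positivity, min_le_left _ _, min_le_right _ _⟩
  have hfun : ∀ x ∈ Metric.ball (0 : ℂ) ε, ∀ y ∈ Metric.ball (0 : ℂ) ε,
      g (0, x • V) - g (0, y • V) =
        (2 * (x - y)) • (Φ (x • V) * Z * ζ ^ 2 + Φ' (y • V) * ζ * Z ^ 2) := by
    intro x hx y hy
    rw [mem_ball_zero_iff] at hx hy
    obtain ⟨u, hu⟩ := IsAlgClosed.exists_pow_nat_eq ((x - y) / (2 * κ)) (n := 4) (by norm_num)
    have hu4 : 2 * κ * u ^ 4 = x - y := by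
      rw [hu]
      field_simp
    have hun : ‖u‖ < δ := by
      have h1 : 2 * ‖κ‖ * ‖u‖ ^ 4 = ‖x - y‖ := by
        rw [← hu4]
        simp
      have h2 : ‖x - y‖ < 2 * ε := by
        linarith [norm_sub_le x y]
      have hk : 0 < ‖κ‖ := norm_pos_iff.2 hκ
      have h3 : ‖u‖ ^ 4 < δ ^ 4 := by
        refine lt_of_mul_lt_mul_left (a := 2 * ‖κ‖) ?_ (by positivity)
        linarith
      exact lt_of_pow_lt_pow_left₀ 4 hδ.le h3
    obtain ⟨e1, e2, e3⟩ := hb (u, x, y) (by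
      rw [mem_ball_zero_iff, Prod.norm_def, Prod.norm_def, max_lt_iff, max_lt_iff]
      exact ⟨hun, hx.trans_le hεδ, hy.trans_le hεδ⟩)
    have hP : x • V - (2 * κ) • ((u • Z) ^ 2 * (u • ζ) ^ 2) = y • V := by
      have : (2 * κ) • ((u • Z) ^ 2 * (u • ζ) ^ 2) = (2 * κ * u ^ 4) • V := by
        rw [hV]
        simp only [Algebra.smul_def, map_mul, map_pow]
        ring
      rw [this, hu4, ← sub_smul]
      congr 1
      ring
    simp only [hP, hg] at e1 e2 e3
    rw [hg2, e2, e3] at e1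
    rw [e1, show 2 * (x - y) = 4 * κ * u ^ 4 by rw [← hu4]; ring]
    simp only [Algebra.smul_def, map_mul, map_pow]
    ring
  have hx₁ : ((ε / 2 : ℝ) : ℂ) ∈ Metric.ball (0 : ℂ) ε := by
    rw [mem_ball_zero_iff, Complex.norm_real, Real.norm_of_nonneg (by positivity)]
    linarith
  obtain ⟨c, hc⟩ := affine_of_functional_equation (h := fun x : ℂ => g (0, x • V))
    (a := fun x => Φ (x • V) * Z * ζ ^ 2) (b := fun y => Φ' (y • V) * ζ * Z ^ 2)
    (Metric.mem_ball_self hε) hfun hx₁ (by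
      simpa using hε.ne')
  obtain ⟨w, hw⟩ := (hZ.mul (hζ.pow 2)).exists_right_inv
  refine ⟨c * w, (2 : ℂ) • (Φ 0 * Z * ζ ^ 2 + Φ' 0 * ζ * Z ^ 2), (2 : ℂ) • c, ?_⟩
  filter_upwards [Metric.ball_mem_nhds 0 hε] with x hx
  obtain ⟨h1, h2⟩ := hc x hx
  simp only [zero_smul] at h1 h2
  refine ⟨?_, h2⟩
  have e : Φ (x • V) * (Z * ζ ^ 2) * w = Φ 0 * (Z * ζ ^ 2) * w + x • (c * w) := by
    rw [← mul_assoc, h1, add_mul, smul_mul_assoc, mul_assoc (Φ 0)]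
  rwa [mul_assoc, hw, mul_one, mul_assoc, hw, mul_one] at e

/-- Dividing a square root of the second entry by the first gives `ζ`. The directions `(Z, Z² ζ²)`
with unit `Z`, `ζ` therefore contain an open set. -/
theorem eventually_exists_units : ∀ᶠ p in 𝓝 ((1, 1) : Cplx S × Cplx S), IsUnit p.1 ∧
    ∃ ζ : Cplx S, IsUnit ζ ∧ p.1 ^ 2 * ζ ^ 2 = p.2 := by
  have t1 := (continuous_fst (X := Cplx S) (Y := Cplx S)).tendsto (1, 1)
  have t2 := (continuous_snd (X := Cplx S) (Y := Cplx S)).tendsto (1, 1)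
  have hu : ∀ᶠ z in 𝓝 (1 : Cplx S), IsUnit z := Units.isOpen.mem_nhds isUnit_one
  filter_upwards [t1.eventually hu, t2.eventually hu, t2.eventually eventually_exists_sq]
    with p h1 h2 h3
  refine ⟨h1, ?_⟩
  obtain ⟨η, hη⟩ := h3
  obtain ⟨w, hw⟩ := h1.exists_right_inv
  have hηu : IsUnit η := by
    rw [← hη] at h2
    exact isUnit_of_dvd_unit (Dvd.intro_left η (pow_two η).symm) h2
  have hwu : IsUnit w := IsUnit.of_mul_eq_one p.1 (by rw [mul_comm, hw])
  refine ⟨η * w, hηu.mul hwu, ?_⟩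
  have : p.1 ^ 2 * (η * w) ^ 2 = η ^ 2 * (p.1 * w) ^ 2 := by ring
  rw [this, hw, one_pow, mul_one, hη]

/-- The jets of a function which is quadratic along a line. -/
theorem jets_of_quadratic {E F : Type*} [NormedAddCommGroup E] [NormedSpace ℂ E]
    [NormedAddCommGroup F] [NormedSpace ℂ F] [CompleteSpace F] {G : E → F}
    (hG : AnalyticAt ℂ G 0) {v : E} {c₁ c₂ : F}
    (h : ∀ᶠ x in 𝓝 (0 : ℂ), G (x • v) = G 0 + x • c₁ + x ^ 2 • c₂) :
    c₁ = fderiv ℂ G 0 v ∧ (2 : ℂ) • c₂ = fderiv ℂ (fderiv ℂ G) 0 v v := by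
  have hline : Continuous fun x : ℂ => x • v := by fun_prop
  have hl : ∀ x : ℂ, HasDerivAt (fun x : ℂ => x • v) v x := fun x => by
    simpa using (hasDerivAt_id x).smul_const v
  have hlt := tendsto_zero_of_eq_zero hline (zero_smul ℂ v)
  have hd : ∀ᶠ x in 𝓝 (0 : ℂ), fderiv ℂ G (x • v) v = c₁ + x • ((2 : ℂ) • c₂) := by
    filter_upwards [hlt.eventually hG.eventually_analyticAt, h.eventually_nhds] with x hx hx2
    have h1 : HasDerivAt (fun x : ℂ => G (x • v)) (fderiv ℂ G (x • v) v) x :=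
      HasFDerivAt.comp_hasDerivAt (l := G) x hx.differentiableAt.hasFDerivAt (hl x)
    have h2 : HasDerivAt (fun x : ℂ => G 0 + x • c₁ + x ^ 2 • c₂) (c₁ + x • ((2 : ℂ) • c₂)) x := by
      have := (((hasDerivAt_id x).smul_const c₁).const_add (G 0)).add
        (((hasDerivAt_id x).pow 2).smul_const c₂)
      have e : c₁ + x • ((2 : ℂ) • c₂) =
          (1 : ℂ) • c₁ + (((2 : ℕ) : ℂ) * id x ^ (2 - 1) * 1) • c₂ := by
        simp [smul_smul, mul_comm]
      rw [e]
      exact this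
    exact h1.unique (h2.congr_of_eventuallyEq hx2)
  refine ⟨by simpa using hd.self_of_nhds.symm, ?_⟩
  have h1 : HasDerivAt (fun x : ℂ => fderiv ℂ G (x • v) v) (fderiv ℂ (fderiv ℂ G) 0 v v) 0 := by
    have h3 : HasFDerivAt (fderiv ℂ G) (fderiv ℂ (fderiv ℂ G) 0) ((0 : ℂ) • v) := by
      rw [zero_smul]
      exact hG.fderiv.differentiableAt.hasFDerivAt
    have := HasFDerivAt.comp_hasDerivAt (l := fderiv ℂ G) 0 h3 (hl 0)
    simpa using this.clm_apply (hasDerivAt_const 0 v)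
  have h2 : HasDerivAt (fun x : ℂ => c₁ + x • ((2 : ℂ) • c₂)) ((2 : ℂ) • c₂) 0 := by
    simpa using ((hasDerivAt_id (0 : ℂ)).smul_const ((2 : ℂ) • c₂)).const_add c₁
  exact (h2.congr_of_eventuallyEq hd).unique h1

/-- The second derivative as a bilinear map. -/
def secondDeriv {E F : Type*} [NormedAddCommGroup E] [NormedSpace ℂ E]
    [NormedAddCommGroup F] [NormedSpace ℂ F] (G : E → F) : E →ₗ[ℂ] E →ₗ[ℂ] F :=
  LinearMap.mk₂ ℂ (fun v w => fderiv ℂ (fderiv ℂ G) 0 v w) (by simp) (by simp) (by simp) (by simp)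

theorem secondDeriv_apply {E F : Type*} [NormedAddCommGroup E] [NormedSpace ℂ E]
    [NormedAddCommGroup F] [NormedSpace ℂ F] (G : E → F) (v w : E) :
    secondDeriv G v w = fderiv ℂ (fderiv ℂ G) 0 v w := rfl

/-- The normal form of a solution of the complexified tangency condition. -/
theorem Polarized.exists_normal_form {κ : ℂ} (hκ : κ ≠ 0)
    {f g f' g' : Cplx S × Cplx S → Cplx S} (h₀ : Polarized κ f g f' g') (hfa : AnalyticAt ℂ f 0)
    (hga : AnalyticAt ℂ g 0) (hf'd : ∀ᶠ p in 𝓝 0, DifferentiableAt ℂ f' p) :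
    ∃ (L : Cplx S →ₗ[ℂ] Cplx S) (B : Cplx S →ₗ[ℂ] Cplx S →ₗ[ℂ] Cplx S) (q : Cplx S)
      (R : Cplx S →ₗ[ℂ] Cplx S) (r : Cplx S →ₗ[ℂ] Cplx S →ₗ[ℂ] Cplx S),
      (∀ W W', r W W' = r W' W) ∧ ∀ᶠ p in 𝓝 (0 : Cplx S × Cplx S),
        f p = L p.1 + B p.2 p.1 ∧ g p = q + R p.2 + r p.2 p.2 := by
  have h := h₀.reduce
  set G : Cplx S → Cplx S := fun P => g (0, P) with hG
  set γ : Cplx S × Cplx S → Cplx S := fun p => G p.2 with hγ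
  have hin : AnalyticAt ℂ (fun P : Cplx S => ((0 : Cplx S), P)) 0 :=
    analyticAt_const.prod analyticAt_id
  have hGa : AnalyticAt ℂ G 0 := AnalyticAt.comp (g := g) hga hin
  have hsnd : Filter.Tendsto (fun p : Cplx S × Cplx S => p.2) (𝓝 0) (𝓝 0) :=
    continuous_snd.tendsto _
  have hγd : ∀ᶠ p in 𝓝 0, DifferentiableAt ℂ γ p := by
    filter_upwards [hsnd.eventually hGa.eventually_analyticAt] with p hp
    exact hp.differentiableAt.comp p differentiableAt_snd
  have hfd : ∀ᶠ p in 𝓝 0, DifferentiableAt ℂ f p :=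
    hfa.eventually_analyticAt.mono fun p hp => hp.differentiableAt
  have hγ0 : ∀ p, γ p = γ (0, p.2) := fun p => rfl
  have hκ' : -κ ≠ 0 := neg_ne_zero.2 hκ
  have hz' := h.eventually_zero hκ hγ0 (hf'd.mono fun p hp => hp.continuousAt)
  have hz := h.symm.eventually_zero hκ' hγ0 (hfd.mono fun p hp => hp.continuousAt)
  obtain ⟨M, hM⟩ := h.eventually_mul_eq hκ hγ0 hγ0 hf'd hγd
  obtain ⟨M', hM'⟩ := h.symm.eventually_mul_eq hκ' hγ0 hγ0 hfd hγd
  let L : Cplx S →ₗ[ℂ] Cplx S :=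
    ((fderiv ℂ f 0).comp (ContinuousLinearMap.inl ℂ (Cplx S) (Cplx S)) : Cplx S →L[ℂ] Cplx S)
  let B : Cplx S →ₗ[ℂ] Cplx S →ₗ[ℂ] Cplx S :=
    (secondDeriv f).compl₁₂ (LinearMap.inr ℂ (Cplx S) (Cplx S)) (LinearMap.inl ℂ _ _)
  let R : Cplx S →ₗ[ℂ] Cplx S := (fderiv ℂ G 0 : Cplx S →L[ℂ] Cplx S)
  let r : Cplx S →ₗ[ℂ] Cplx S →ₗ[ℂ] Cplx S := (2⁻¹ : ℂ) • secondDeriv G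
  -- On each such line, `f` and `G` are polynomials of degree at most two in `s`; their coefficients
  -- are identified with the jets at the origin that define `L`, `B`, `R`, `r`.
  have hline : ∀ᶠ p in 𝓝 ((1, 1) : Cplx S × Cplx S), ∀ᶠ s : ℂ in 𝓝 0,
      f (s • p) - (L (s • p).1 + B (s • p).2 (s • p).1) = 0 ∧
      G (s • p).2 - (G 0 + R (s • p).2 + r (s • p).2 (s • p).2) = 0 := by
    filter_upwards [eventually_exists_units] with p hp
    obtain ⟨hZ, ζ, hζ, hV⟩ := hp
    obtain ⟨Z, V⟩ := p
    simp only at hZ hV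
    have hZ1 := eventually_smul_eq hM hfd hz hZ
    obtain ⟨c, c₁, c₂, hc⟩ := h.exists_affine hκ hγ0 hγ0 hZ hζ
      (Φ := fun P => fderiv ℂ f (0, P) (Z, 0)) (Φ' := fun P => fderiv ℂ f' (0, P) (ζ, 0)) hZ1
      (eventually_smul_eq hM' hf'd hz' hζ)
    rw [hV] at hc
    have hcB : c = B V Z := by
      have hl : HasDerivAt (fun x : ℂ => ((0 : Cplx S), x • V)) ((0 : Cplx S), V) 0 := by
        simpa using (hasDerivAt_const (0 : ℂ) (0 : Cplx S)).prodMk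
          ((hasDerivAt_id (0 : ℂ)).smul_const V)
      have h3 : HasFDerivAt (fderiv ℂ f) (fderiv ℂ (fderiv ℂ f) 0) ((0 : Cplx S), (0 : ℂ) • V) := by
        rw [zero_smul]
        exact hfa.fderiv.differentiableAt.hasFDerivAt
      have h1 := (HasFDerivAt.comp_hasDerivAt (l := fderiv ℂ f) 0 h3 hl).clm_apply
        (hasDerivAt_const 0 (Z, (0 : Cplx S)))
      have h2 : HasDerivAt (fun x : ℂ => fderiv ℂ f (0, 0) (Z, 0) + x • c) c 0 := by
        simpa using ((hasDerivAt_id (0 : ℂ)).smul_const c).const_add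
          (fderiv ℂ f (0, 0) (Z, (0 : Cplx S)))
      have := (h2.congr_of_eventuallyEq (hc.mono fun x hx => hx.1)).unique h1
      rw [this]
      simp [B, secondDeriv_apply]
    obtain ⟨hc1, hc2⟩ := jets_of_quadratic hGa (v := V) (c₁ := c₁) (c₂ := c₂)
      (hc.mono fun x hx => hx.2)
    have t : Filter.Tendsto (fun s : ℂ => (s, s • V)) (𝓝 0) (𝓝 0) :=
      tendsto_zero_of_eq_zero (by fun_prop) (by simp)
    filter_upwards [hc, t.eventually hZ1] with s hs hs1
    refine ⟨?_, ?_⟩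
    · simp only [Prod.smul_mk]
      rw [hs1, hs.1, hcB, sub_eq_zero]
      simp only [map_smul, LinearMap.smul_apply, smul_add]
      rfl
    · simp only [Prod.smul_mk]
      have e : r V V = c₂ := by
        simp [r, secondDeriv_apply, ← hc2, smul_smul]
      have e2 : G (s • V) = G 0 + s • c₁ + s ^ 2 • c₂ := hs.2
      rw [e2, hc1, ← e, sub_eq_zero]
      simp only [map_smul, LinearMap.smul_apply, smul_smul, pow_two]
      rfl
  have hLa : AnalyticAt ℂ (fun p : Cplx S × Cplx S => L p.1) 0 :=
    (L.toContinuousLinearMap.analyticAt _).comp analyticAt_fst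
  have hRa : AnalyticAt ℂ (fun p : Cplx S × Cplx S => R p.2) 0 :=
    (R.toContinuousLinearMap.analyticAt _).comp analyticAt_snd
  have hf := eventually_zero_of_eventually_cone (H := fun p : Cplx S × Cplx S =>
    f p - (L p.1 + B p.2 p.1))
    (hfa.sub (hLa.add (analyticAt_bilin B analyticAt_snd analyticAt_fst)))
    (hline.mono fun p hp => hp.mono fun s hs => hs.1)
  have hGsnd : AnalyticAt ℂ (fun p : Cplx S × Cplx S => G p.2) 0 :=
    AnalyticAt.comp (g := G) hGa analyticAt_snd
  have hg := eventually_zero_of_eventually_cone (H := fun p : Cplx S × Cplx S =>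
    G p.2 - (G 0 + R p.2 + r p.2 p.2))
    (hGsnd.sub ((analyticAt_const.add hRa).add (analyticAt_bilin r analyticAt_snd analyticAt_snd)))
    (hline.mono fun p hp => hp.mono fun s hs => hs.2)
  refine ⟨L, B, G 0, R, r, fun W W' => ?_, ?_⟩
  · have hs : IsSymmSndFDerivAt ℂ G 0 :=
      hGa.contDiffAt.isSymmSndFDerivAt (n := ⊤) (by simp)
    have := hs W W'
    simp [r, secondDeriv_apply, this]
  · have hin0 : Filter.Tendsto (fun p : Cplx S × Cplx S => ((0 : Cplx S), p.2)) (𝓝 0) (𝓝 0) :=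
      tendsto_zero_of_eq_zero (by fun_prop) (by simp)
    filter_upwards [hf, hg, h₀.eventually_eq, hin0.eventually h₀.eventually_eq] with p h1 h2 h3 h4
    refine ⟨sub_eq_zero.1 h1, ?_⟩
    rw [h3, ← h4]
    exact sub_eq_zero.1 h2

end Jets

end

theorem mainTheorem4 (S : Type*) [CommRing S] [Algebra ℝ S] [FiniteDimensional ℝ S] :
    -- (a) nondegeneracy: independence of the coordinates of the form, finite type, and
    -- holomorphic nondegeneracy
    (CoordinatesIndependent (fun Z : Cplx S => (quarticForm S Z (conj Z)).re) ∧
      (∀ p ∈ quartic S, FiniteTypeAt (quarticFun S) p) ∧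
      (∀ p ∈ quartic S, HolNondegenerateAt (quarticFun S) p)) ∧
    -- (b) the full-dimension condition
    FullDimension (quarticForm S) ∧
    -- (c) the description of the infinitesimal automorphisms
    (∀ X : Cplx S × Cplx S → Cplx S × Cplx S, X ∈ infAut (quarticFun S) ↔
      ∃ (L : Cplx S →ₗ[ℂ] Cplx S) (B : Cplx S →ₗ[ℂ] Cplx S →ₗ[ℂ] Cplx S) (q : S)
        (R : Cplx S →ₗ[ℂ] Cplx S) (r : Cplx S →ₗ[ℂ] Cplx S →ₗ[ℂ] Cplx S),
        (∀ᶠ p in 𝓝 (0 : Cplx S × Cplx S),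
          X p = (L p.1 + B p.2 p.1, Cplx.ofReal q + R p.2 + r p.2 p.2)) ∧
        (∀ U : S, (R (Cplx.ofReal U)).im = 0) ∧
        (∀ W W' : Cplx S, r W W' = r W' W) ∧
        (∀ U : S, (r (Cplx.ofReal U) (Cplx.ofReal U)).im = 0) ∧
        (∀ Z : Cplx S,
          Cplx.ofReal (4 * (L Z * Z * conj Z ^ 2).re) = R (Z ^ 2 * conj Z ^ 2)) ∧
        (∀ (U : S) (Z : Cplx S),
          Cplx.ofReal (2 * (B (Cplx.ofReal U) Z * Z * conj Z ^ 2).re) =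
            r (Cplx.ofReal U) (Z ^ 2 * conj Z ^ 2)) ∧
        (∀ Z : Cplx S, (B (Z ^ 2 * conj Z ^ 2) Z * Z * conj Z ^ 2).im = 0)) := by
  refine ⟨⟨coordinatesIndependent_quarticForm S, fun p _ => finiteTypeAt_quarticFun p,
    fun p hp => holNondegenerateAt_quarticFun hp⟩, fullDimension_quarticForm S,
    fun X => ⟨fun hX => ?_, ?_⟩⟩
  · have hconj : Filter.Tendsto (fun p : Cplx S × Cplx S => (conj p.1, conj p.2)) (𝓝 0) (𝓝 0) :=
      tendsto_zero_of_eq_zero ((Cplx.continuous_conj.comp continuous_fst).prodMk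
        (Cplx.continuous_conj.comp continuous_snd)) (by simp)
    have hd : ∀ᶠ p in 𝓝 (0 : Cplx S × Cplx S),
        DifferentiableAt ℂ (fun p => conj (X (conj p.1, conj p.2)).1) p := by
      filter_upwards [hconj.eventually hX.1.eventually_analyticAt] with p hp
      exact Cplx.differentiableAt_conj_comp
        ((Cplx.conjCLM (S := S)).prodMap (Cplx.conjCLM (S := S)))
        (fun t v => Prod.ext (Cplx.conj_smul t v.1) (Cplx.conj_smul t v.2))
        hp.differentiableAt.fst
    obtain ⟨L, B, q, R, r, hr, hform⟩ := (polarized_of_mem_infAut hX).exists_normal_form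
      Complex.I_ne_zero (analyticAt_fst.comp hX.1) (analyticAt_snd.comp hX.1) hd
    have hform' : ∀ᶠ p in 𝓝 (0 : Cplx S × Cplx S),
        X p = (L p.1 + B p.2 p.1, q + R p.2 + r p.2 p.2) :=
      hform.mono fun p hp => Prod.ext hp.1 hp.2
    obtain ⟨hq, hR, hri, h1, h2, h3⟩ := relations_of_eventually_tangent hr
      ((hform'.and hX.2).mono fun p hp hpQ => hp.1 ▸ hp.2 hpQ)
    rw [Cplx.eq_ofReal_re hq] at hform'
    exact ⟨L, B, q.re, R, r, hform', hR, hr, hri, h1, h2, h3⟩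
  · rintro ⟨L, B, q, R, r, hX, hR, hr, hri, h1, h2, h3⟩
    exact mem_infAut_of_relations hX hR hr hri h1 h2 h3
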